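/- **Setting.** Let $g_{12},g_{21},g_{10},g_{20}>0$ be the amplitude gains of the links user 1→user 2, user 2→user 1, user 1→destination and user 2→destination in a Gaussian multiple access channel with unit noise, let $P_1,P_2>0$ be the powers, and let $C(x)=\log_2(1+x)$. In the three-phase half-duplex scheme with phase durations $\alpha_1,\alpha_2\ge 0$, $\alpha_3=1-\alpha_1-\alpha_2\ge 0$, user $i$ splits its message as $w_1=(w_{10},w_{12})$, $w_2=(w_{20},w_{21})$. With unit-power Gaussian codewords $U_1,U_2,U_3,V_1,V_2$, it transmits $X_{11}=\sqrt{\rho_{11}}U_1(w_{12})$ (user 1, phase 1), $X_{22}=\sqrt{\rho_{22}}U_2(w_{21})$ (user 2, phase 2), and in phase 3 $X_{13}=\sqrt{\rho_{10}}V_1(w_{10})+\sqrt{\rho_{13}}U_3(w_{12},w_{21})$ (user 1), $X_{23}=\sqrt{\rho_{20}}V_2(w_{20})+\sqrt{\rho_{23}}U_3(w_{12},w_{21})$ (user 2). The powers are nonnegative with $\alpha_1\rho_{11}+\alpha_3(\rho_{10}+\rho_{13})=P_1$ and $\alpha_2\rho_{22}+\alpha_3(\rho_{20}+\rho_{23})=P_2$.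 User 2 decodes $w_{12}$ after phase 1, user 1 decodes $w_{21}$ after phase 2, and the destination decodes everything jointly at the end of phase 3 from what it received in all phases. Put $\zeta=g_{10}^2(\rho_{10}+\rho_{13})+g_{20}^2(\rho_{20}+\rho_{23})+2g_{10}g_{20}\sqrt{\rho_{13}\rho_{23}}$, $I_1=\alpha_1C(g_{12}^2\rho_{11})$, $I_2=\alpha_2C(g_{21}^2\rho_{22})$, $I_3=\alpha_3C(g_{10}^2\rho_{10})$, $I_4=\alpha_3C(g_{20}^2\rho_{20})$, $I_5=\alpha_3C(g_{10}^2\rho_{10}+g_{20}^2\rho_{20})$, $I_6=\alpha_1C(g_{10}^2\rho_{11})+\alpha_3C(\zeta)$, $I_7=\alpha_2C(g_{20}^2\rho_{22})+\alpha_3C(\zeta)$, $I_8=I_6+\alpha_2C(g_{20}^2\rho_{22})$. Decodability of the parts means $R_{12}\le I_1$, $R_{21}\le I_2$, $R_{10}\le I_3$, $R_{20}\le I_4$, $R_{10}+R_{20}\le I_5$, $R_1+R_{20}\le I_6$, $R_{10}+R_2\le I_7$, $R_1+R_2\le I_8$, where $R_1=R_{10}+R_{12}$ and $R_2=R_{20}+R_{21}$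 are the rates of $w_1$ and $w_2$. The rate region is given by $R_1,R_2\ge0$, $R_1\le J_1=I_1+I_3$, $R_2\le I_2+I_4$ and $R_1+R_2\le\min\{I_1+I_2+I_5,\ I_2+I_6,\ I_1+I_7,\ S_4\}$ with $S_4=I_8$. The individual rate is the largest $R_1$ with $(R_1,0)$ in this region. **Case 1: $g_{12}<g_{10}$.** The largest individual rate over all phase durations and powers is $C(g_{10}^2P_1)$, and this stays so if user 2 spends any power $Q\in[0,P_2]$ instead of $P_2$. It is reached only with $\alpha_1=\alpha_2=0$, $\rho_{10}=P_1$, $\rho_{13}=0$, and it is reached by direct transmission: user 1 sends $w_1=w_{10}$ during the whole time and user 2 stays silent. **Otherwise, $g_{12}\ge g_{10}$; fix $\alpha_1=\alpha\in(0,1)$.** The largest individual rate over the three-phase scheme with $\alpha_1=\alpha$ is attained with $\alpha_2=0$, $\rho_{22}=\rho_{20}=0$, $\rho_{23}=P_2/(1-\alpha)$, and so equals the value of the problem: maximize $R$ subject to $R\le J_1$, $R\le S_4$, $\alpha\rho_{11}+(1-\alpha)(\rho_{10}+\rho_{13})=P_1$, $\rho_{10},\rho_{11},\rho_{13}\ge0$.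 This problem has exactly one solution $(R,\rho_{10},\rho_{11},\rho_{13})$. A point is the solution if and only if it satisfies the KKT conditions for some multipliers $\lambda_0,\lambda_1,\lambda_2\ge0$ (of $R\le J_1$, of $R\le S_4$, and of the power equality) and $\mu_{10},\mu_{11},\mu_{13}\ge0$ (of $\rho_i\ge0$). For any such multipliers exactly one of the following four cases holds. Write $a_1=g_{10}^{-2}-g_{12}^{-2}$, $a_2=g_{10}^{-2}+\rho_{11}$, $a_3=g_{12}^{-2}+\rho_{11}$, $a_4=1+\frac{g_{20}}{g_{10}}\sqrt{\rho_{23}/\rho_{13}}$, $a_5=\rho_{13}+\frac{g_{20}^2}{g_{10}^2}\rho_{23}+2\frac{g_{20}}{g_{10}}\sqrt{\rho_{13}\rho_{23}}$. * **Case 2.a: $\lambda_1>0$, $\mu_{10}=0$.** Then $\lambda_0>0$, $R=J_1=S_4$, $\rho_{13}>0$, and $\rho_{11}=(2a_4)^{-1}\big(b_1+\sqrt{b_1^2-4a_4b_2}\big)-g_{10}^{-2}$, $\ \rho_{10}=(a_4-1+a_3/a_2)^{-1}\big(a_4a_3-(a_3/a_2)a_5\big)-g_{10}^{-2}$, with $b_1=a_4(P_1+g_{10}^{-2}-(1-\alpha)\rho_{13})+\alpha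 a_1+(1-\alpha)(a_4a_1+a_5)$ and $b_2=a_1P_1+(1-\alpha)a_1\frac{g_{20}^2}{g_{10}^2}\rho_{23}+g_{10}^{-2}a_1+2(1-\alpha)a_1\frac{g_{20}}{g_{10}}\sqrt{\rho_{13}\rho_{23}}$. With these expressions for $\rho_{11}$ and $\rho_{10}$ in terms of $\rho_{13}$, the power $\rho_{13}$ is a root of $f_2=\frac{P_1-\alpha\rho_{11}}{1-\alpha}-\rho_{13}-g_{10}^{-2}\big(2^{f_1/(1-\alpha)}-1\big)$, where $f_1=\alpha C(g_{10}^2\rho_{11})+(1-\alpha)C(g_{10}^2(\rho_{10}+a_5))-\alpha C(g_{12}^2\rho_{11})$. The optimal scheme is partial decode-forward with message repetition: user 1 sends $w_{12}$ in phase 1, user 2 decodes it, and in phase 3 user 1 sends $(w_{10},w_{12})$ and user 2 sends $w_{12}$. (In the degenerate event $\rho_{10}=0$ it is decode-forward, as in Case 2.b.) * **Case 2.b: $\lambda_1>0$, $\mu_{10}>0$.** Then $R=S_4$, $\rho_{10}=0$, $\rho_{13}>0$ and $\rho_{11}=\alpha^{-1}(P_1-(1-\alpha)\rho_{13})$. If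 $\lambda_0>0$, then also $R=J_1$ and $\rho_{13}$ is a root of $f_4=\frac{P_1-(1-\alpha)\rho_{13}}{\alpha}-g_{10}^{-2}\Big(\frac{1-g_{12}^2g_{10}^{-2}}{2^{f_3}-g_{12}^2g_{10}^{-2}}-1\Big)$ with $f_3=\frac{1-\alpha}{\alpha}C(g_{10}^2a_5)$. If $\lambda_0=0$, then $a_4a_2=g_{10}^{-2}+a_5$. The optimal scheme is decode-forward: user 1 sends $w_1=w_{12}$ in phase 1, user 2 decodes it, and both users send $w_1$ in phase 3. * **Case 3.a: $\lambda_1=0$, $\mu_{10}=0$.** Then $\lambda_0>0$, $\mu_{13}>0$, $R=J_1$, $\rho_{13}=0$, $\rho_{11}=P_1+(1-\alpha)a_1$, $\rho_{10}=P_1-\alpha a_1$. The optimal scheme is partial decode-forward without message repetition: user 1 sends $w_{12}$ in phase 1, user 2 decodes it, and in phase 3 user 1 sends $w_{10}$ and user 2 sends $w_{12}$. (In the degenerate event $\rho_{10}=0$ it is two-hop transmission, as in Case 3.b.) * **Case 3.b: $\lambda_1=0$, $\mu_{10}>0$.** Then $\lambda_0>0$, $\mu_{13}>0$, $R=J_1$,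 $\rho_{13}=\rho_{10}=0$, $\rho_{11}=P_1/\alpha$. The optimal scheme is two-hop transmission: user 1 sends $w_1=w_{12}$ in phase 1, user 2 decodes it, and in phase 3 user 2 sends $w_1$ while user 1 stays silent. If $J_1=S_4$ holds for no valid power allocation of the problem, then Case 3.a or 3.b holds. -/

import Mathlib

namespace RelayMAC

noncomputable section

/-- `C(x) = log₂(1 + x)`, rates being measured in bits per channel use. -/
def cap (x : ℝ) : ℝ := Real.logb 2 (1 + x)

/-- Amplitude gains of the links user 1 → user 2, user 2 → user 1, user 1 → destination and
user 2 → destination. -/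
structure Gains where
  g12 : ℝ
  g21 : ℝ
  g10 : ℝ
  g20 : ℝ

/-- All links are present. -/
def Gains.Pos (g : Gains) : Prop := 0 < g.g12 ∧ 0 < g.g21 ∧ 0 < g.g10 ∧ 0 < g.g20

/-! ### The three-phase scheme -/

/-- Phase durations and powers of the three-phase scheme, with transmit signals
* phase 1, user 1: `X₁₁ = √ρ11 U₁(w12)`;
* phase 2, user 2: `X₂₂ = √ρ22 U₂(w21)`;
* phase 3, user 1: `X₁₃ = √ρ10 V₁(w10) + √ρ13 U₃(w12, w21)`;
* phase 3, user 2: `X₂₃ = √ρ20 V₂(w20) + √ρ23 U₃(w12, w21)`. -/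
structure Design where
  α1 : ℝ
  α2 : ℝ
  ρ10 : ℝ
  ρ20 : ℝ
  ρ11 : ℝ
  ρ22 : ℝ
  ρ13 : ℝ
  ρ23 : ℝ

namespace Design

/-- Duration of the third phase. -/
def α3 (d : Design) : ℝ := 1 - d.α1 - d.α2

/-- Admissible durations and powers, user 1 spending average power `p1` and user 2 spending
average power `p2`. -/
def Feasible (d : Design) (p1 p2 : ℝ) : Prop :=
  0 ≤ d.α1 ∧ 0 ≤ d.α2 ∧ d.α1 + d.α2 ≤ 1 ∧
  0 ≤ d.ρ10 ∧ 0 ≤ d.ρ20 ∧ 0 ≤ d.ρ11 ∧ 0 ≤ d.ρ22 ∧ 0 ≤ d.ρ13 ∧ 0 ≤ d.ρ23 ∧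
  d.α1 * d.ρ11 + d.α3 * (d.ρ10 + d.ρ13) = p1 ∧
  d.α2 * d.ρ22 + d.α3 * (d.ρ20 + d.ρ23) = p2

/-- Received signal power at the destination in the third phase. -/
def ζ (g : Gains) (d : Design) : ℝ :=
  g.g10 ^ 2 * (d.ρ10 + d.ρ13) + g.g20 ^ 2 * (d.ρ20 + d.ρ23)
    + 2 * g.g10 * g.g20 * √(d.ρ13 * d.ρ23)

def I1 (g : Gains) (d : Design) : ℝ := d.α1 * cap (g.g12 ^ 2 * d.ρ11)
def I2 (g : Gains) (d : Design) : ℝ := d.α2 * cap (g.g21 ^ 2 * d.ρ22)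
def I3 (g : Gains) (d : Design) : ℝ := d.α3 * cap (g.g10 ^ 2 * d.ρ10)
def I4 (g : Gains) (d : Design) : ℝ := d.α3 * cap (g.g20 ^ 2 * d.ρ20)
def I5 (g : Gains) (d : Design) : ℝ := d.α3 * cap (g.g10 ^ 2 * d.ρ10 + g.g20 ^ 2 * d.ρ20)
def I6 (g : Gains) (d : Design) : ℝ := d.α1 * cap (g.g10 ^ 2 * d.ρ11) + d.α3 * cap (d.ζ g)
def I7 (g : Gains) (d : Design) : ℝ := d.α2 * cap (g.g20 ^ 2 * d.ρ22) + d.α3 * cap (d.ζ g)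
def I8 (g : Gains) (d : Design) : ℝ :=
  d.α1 * cap (g.g10 ^ 2 * d.ρ11) + d.α2 * cap (g.g20 ^ 2 * d.ρ22) + d.α3 * cap (d.ζ g)

def J1 (g : Gains) (d : Design) : ℝ := d.I1 g + d.I3 g
def J2 (g : Gains) (d : Design) : ℝ := d.I2 g + d.I4 g
def S1 (g : Gains) (d : Design) : ℝ := d.I1 g + d.I2 g + d.I5 g
def S2 (g : Gains) (d : Design) : ℝ := d.I2 g + d.I6 g
def S3 (g : Gains) (d : Design) : ℝ := d.I1 g + d.I7 g
def S4 (g : Gains) (d : Design) : ℝ := d.I8 g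

/-- The rate pair `(R1, R2)` lies in the rate region of the scheme with parameters `d`. -/
def InRegion (g : Gains) (d : Design) (R1 R2 : ℝ) : Prop :=
  0 ≤ R1 ∧ 0 ≤ R2 ∧ R1 ≤ d.J1 g ∧ R2 ≤ d.J2 g ∧ R1 + R2 ≤ d.S1 g ∧ R1 + R2 ≤ d.S2 g ∧
  R1 + R2 ≤ d.S3 g ∧ R1 + R2 ≤ d.S4 g

end Design

/-- Individual rates `R1` (with `R2 = 0`) of the scheme over all phase durations and powers. -/
def individualRates (g : Gains) (p1 p2 : ℝ) : Set ℝ :=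
  {R | ∃ d : Design, d.Feasible p1 p2 ∧ d.InRegion g R 0}

/-- Individual rates `R1` (with `R2 = 0`) of the scheme with first phase of duration `α`. -/
def individualRatesAt (g : Gains) (p1 p2 α : ℝ) : Set ℝ :=
  {R | ∃ d : Design, d.α1 = α ∧ d.Feasible p1 p2 ∧ d.InRegion g R 0}

/-! ### Messages and transmission schemes -/

/-- The private parts `w10`, `w20` and the cooperative parts `w12`, `w21` of
`w1 = (w10, w12)` and `w2 = (w20, w21)`. -/
inductive MessagePart
  | w10 | w12 | w20 | w21

/-- Rates of the four message parts; a part of rate zero is empty. -/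
structure RateSplit where
  R10 : ℝ
  R12 : ℝ
  R20 : ℝ
  R21 : ℝ

def RateSplit.rate (s : RateSplit) : MessagePart → ℝ
  | .w10 => s.R10
  | .w12 => s.R12
  | .w20 => s.R20
  | .w21 => s.R21

/-- Decoding conditions: user 2 decodes `w12` after phase 1, user 1 decodes `w21` after phase 2, and
the destination jointly decodes everything at the end of phase 3 from what it received in all
phases. -/
def Decodable (g : Gains) (d : Design) (s : RateSplit) : Prop :=
  0 ≤ s.R10 ∧ 0 ≤ s.R12 ∧ 0 ≤ s.R20 ∧ 0 ≤ s.R21 ∧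
  s.R12 ≤ d.I1 g ∧ s.R21 ≤ d.I2 g ∧
  s.R10 ≤ d.I3 g ∧ s.R20 ≤ d.I4 g ∧ s.R10 + s.R20 ≤ d.I5 g ∧
  (s.R10 + s.R12) + s.R20 ≤ d.I6 g ∧ s.R10 + (s.R20 + s.R21) ≤ d.I7 g ∧
  (s.R10 + s.R12) + (s.R20 + s.R21) ≤ d.I8 g

/-- The split `s` delivers user 1's message at total rate `R`, user 2 having no message. -/
def Delivers (g : Gains) (d : Design) (R : ℝ) (s : RateSplit) : Prop :=
  Decodable g d s ∧ s.R10 + s.R12 = R ∧ s.R20 = 0 ∧ s.R21 = 0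

/-- Nonempty message parts sent by user 1 in phase 1. -/
def sent11 (d : Design) (s : RateSplit) : Set MessagePart :=
  {m | 0 < s.rate m ∧ 0 < d.α1 ∧ m = .w12 ∧ 0 < d.ρ11}

/-- Nonempty message parts sent by user 1 in phase 3. -/
def sent13 (d : Design) (s : RateSplit) : Set MessagePart :=
  {m | 0 < s.rate m ∧ 0 < d.α3 ∧
    ((m = .w10 ∧ 0 < d.ρ10) ∨ ((m = .w12 ∨ m = .w21) ∧ 0 < d.ρ13))}

/-- Nonempty message parts sent by user 2 in phase 3. -/
def sent23 (d : Design) (s : RateSplit) : Set MessagePart :=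
  {m | 0 < s.rate m ∧ 0 < d.α3 ∧
    ((m = .w20 ∧ 0 < d.ρ20) ∨ ((m = .w12 ∨ m = .w21) ∧ 0 < d.ρ23))}

/-- Direct transmission: user 1 sends `w1 = w10` all the time, user 2 is silent. -/
def IsDirect (d : Design) (s : RateSplit) : Prop :=
  d.α1 = 0 ∧ d.α2 = 0 ∧ s.R12 = 0 ∧ sent13 d s = {.w10} ∧
  d.ρ22 = 0 ∧ d.ρ20 = 0 ∧ d.ρ23 = 0

/-- Partial decode-forward with message repetition. -/
def IsPDFRepetition (d : Design) (s : RateSplit) : Prop :=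
  d.α2 = 0 ∧ sent11 d s = {.w12} ∧ sent13 d s = {.w10, .w12} ∧ sent23 d s = {.w12}

/-- Full decode-forward: `w1 = w12`, sent by user 1 in phase 1 and by both users in phase 3. -/
def IsDF (d : Design) (s : RateSplit) : Prop :=
  d.α2 = 0 ∧ s.R10 = 0 ∧ sent11 d s = {.w12} ∧ sent13 d s = {.w12} ∧ sent23 d s = {.w12}

/-- Partial decode-forward without message repetition. -/
def IsPDFNoRepetition (d : Design) (s : RateSplit) : Prop :=
  d.α2 = 0 ∧ sent11 d s = {.w12} ∧ sent13 d s = {.w10} ∧ sent23 d s = {.w12}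

/-- Two-hop transmission: `w1 = w12`, sent by user 1 in phase 1 and by user 2 in phase 3, where
user 1 is silent. -/
def IsTwoHop (d : Design) (s : RateSplit) : Prop :=
  d.α2 = 0 ∧ s.R10 = 0 ∧ sent11 d s = {.w12} ∧ d.ρ10 = 0 ∧ d.ρ13 = 0 ∧ sent23 d s = {.w12}

/-- The design `d` delivers rate `R`, and whatever rate split is used for that, it is a scheme of
kind `K`. -/
def UsesScheme (g : Gains) (d : Design) (R : ℝ) (K : Design → RateSplit → Prop) : Prop :=
  (∃ s, Delivers g d R s) ∧ ∀ s, Delivers g d R s → K d s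

/-! ### The relay optimization problem for fixed `α1` -/

/-- Power of user 2 in phase 3 when it spends all its power there. -/
def rho23 (P2 α : ℝ) : ℝ := P2 / (1 - α)

/-- Variables of the problem: the rate and the powers of user 1. -/
structure Point where
  R : ℝ
  ρ10 : ℝ
  ρ11 : ℝ
  ρ13 : ℝ

/-- The reduction of the scheme to two phases. -/
def relayDesign (P2 α : ℝ) (x : Point) : Design where
  α1 := α
  α2 := 0
  ρ10 := x.ρ10
  ρ20 := 0
  ρ11 := x.ρ11
  ρ22 := 0
  ρ13 := x.ρ13
  ρ23 := rho23 P2 α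

/-- `J₁` in the relay problem. -/
def Point.J1 (g : Gains) (P2 α : ℝ) (x : Point) : ℝ := (relayDesign P2 α x).J1 g

/-- `S₄` in the relay problem. -/
def Point.S4 (g : Gains) (P2 α : ℝ) (x : Point) : ℝ := (relayDesign P2 α x).S4 g

/-- The power allocation of `x` is valid. -/
def Point.ValidPower (P1 α : ℝ) (x : Point) : Prop :=
  α * x.ρ11 + (1 - α) * (x.ρ10 + x.ρ13) = P1 ∧ 0 ≤ x.ρ10 ∧ 0 ≤ x.ρ11 ∧ 0 ≤ x.ρ13

/-- `x` satisfies all constraints of the relay problem. -/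
def Point.Feasible (g : Gains) (P1 P2 α : ℝ) (x : Point) : Prop :=
  x.ValidPower P1 α ∧ x.R ≤ x.J1 g P2 α ∧ x.R ≤ x.S4 g P2 α

/-- `x` solves: maximize `R` subject to `R ≤ J₁`, `R ≤ S₄` and the power constraints. -/
def IsOptimal (g : Gains) (P1 P2 α : ℝ) (x : Point) : Prop :=
  x.Feasible g P1 P2 α ∧ ∀ y : Point, y.Feasible g P1 P2 α → y.R ≤ x.R

/-- Lagrange multipliers: of the two rate constraints, of the power equality and of the
non-negativity of the three powers. -/
structure Multipliers where
  lam0 : ℝ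
  lam1 : ℝ
  lam2 : ℝ
  mu10 : ℝ
  mu11 : ℝ
  mu13 : ℝ

/-- The Lagrangian of the relay problem as a function of `(R, ρ10, ρ11, ρ13)`. -/
def lagrangian (g : Gains) (P1 P2 α : ℝ) (m : Multipliers) (v : ℝ × ℝ × ℝ × ℝ) : ℝ :=
  let x : Point := ⟨v.1, v.2.1, v.2.2.1, v.2.2.2⟩
  x.R - m.lam0 * (x.R - x.J1 g P2 α) - m.lam1 * (x.R - x.S4 g P2 α)
    - m.lam2 * (α * x.ρ11 + (1 - α) * (x.ρ10 + x.ρ13) - P1)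
    + (m.mu10 * x.ρ10 + m.mu11 * x.ρ11 + m.mu13 * x.ρ13)

/-- The KKT conditions: stationarity (the Lagrangian is differentiable with zero derivative),
feasibility, signs of the multipliers, complementary slackness. -/
def IsKKT (g : Gains) (P1 P2 α : ℝ) (x : Point) (m : Multipliers) : Prop :=
  HasFDerivAt (lagrangian g P1 P2 α m) (0 : ℝ × ℝ × ℝ × ℝ →L[ℝ] ℝ) (x.R, x.ρ10, x.ρ11, x.ρ13) ∧
  x.Feasible g P1 P2 α ∧
  0 ≤ m.lam0 ∧ 0 ≤ m.lam1 ∧ 0 ≤ m.lam2 ∧ 0 ≤ m.mu10 ∧ 0 ≤ m.mu11 ∧ 0 ≤ m.mu13 ∧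
  m.mu10 * x.ρ10 = 0 ∧ m.mu11 * x.ρ11 = 0 ∧ m.mu13 * x.ρ13 = 0 ∧
  m.lam0 * (x.R - x.J1 g P2 α) = 0 ∧ m.lam1 * (x.R - x.S4 g P2 α) = 0

/-! ### Quantities in the optimal power allocations

`q` is the power `ρ13`, `r` the power `ρ11`, `p` the power `ρ10`. -/

def a1 (g : Gains) : ℝ := (g.g10 ^ 2)⁻¹ - (g.g12 ^ 2)⁻¹
def a2 (g : Gains) (r : ℝ) : ℝ := (g.g10 ^ 2)⁻¹ + r
def a3 (g : Gains) (r : ℝ) : ℝ := (g.g12 ^ 2)⁻¹ + r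
def a4 (g : Gains) (P2 α q : ℝ) : ℝ := 1 + g.g20 / g.g10 * √(rho23 P2 α / q)
def a5 (g : Gains) (P2 α q : ℝ) : ℝ :=
  q + g.g20 ^ 2 / g.g10 ^ 2 * rho23 P2 α + 2 * (g.g20 / g.g10) * √(q * rho23 P2 α)

def b1 (g : Gains) (P1 P2 α q : ℝ) : ℝ :=
  a4 g P2 α q * (P1 + (g.g10 ^ 2)⁻¹ - (1 - α) * q) + α * a1 g
    + (1 - α) * (a4 g P2 α q * a1 g + a5 g P2 α q)

def b2 (g : Gains) (P1 P2 α q : ℝ) : ℝ :=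
  a1 g * P1 + (1 - α) * a1 g * (g.g20 ^ 2 / g.g10 ^ 2) * rho23 P2 α + (g.g10 ^ 2)⁻¹ * a1 g
    + 2 * (1 - α) * a1 g * (g.g20 / g.g10) * √(q * rho23 P2 α)

/-- `ρ11` as a function of `ρ13` in partial decode-forward with repetition. -/
def rho11Of (g : Gains) (P1 P2 α q : ℝ) : ℝ :=
  (2 * a4 g P2 α q)⁻¹ *
      (b1 g P1 P2 α q + √(b1 g P1 P2 α q ^ 2 - 4 * a4 g P2 α q * b2 g P1 P2 α q))
    - (g.g10 ^ 2)⁻¹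

/-- `ρ10` as a function of `ρ11` and `ρ13` in partial decode-forward with repetition. -/
def rho10Of (g : Gains) (P2 α r q : ℝ) : ℝ :=
  (g.g20 / g.g10 * √(rho23 P2 α / q) + a3 g r / a2 g r)⁻¹ *
      ((1 + g.g20 / g.g10 * √(rho23 P2 α / q)) * a3 g r - a3 g r / a2 g r * a5 g P2 α q)
    - (g.g10 ^ 2)⁻¹

def f1 (g : Gains) (P2 α p r q : ℝ) : ℝ :=
  α * cap (g.g10 ^ 2 * r) + (1 - α) * cap (g.g10 ^ 2 * (p + a5 g P2 α q))
    - α * cap (g.g12 ^ 2 * r)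

/-- The function of `ρ13` whose root is sought in partial decode-forward with repetition. -/
def f2 (g : Gains) (P1 P2 α q : ℝ) : ℝ :=
  let r := rho11Of g P1 P2 α q
  let p := rho10Of g P2 α r q
  (1 - α)⁻¹ * (P1 - α * r) - q
    - (g.g10 ^ 2)⁻¹ * ((2 : ℝ) ^ (f1 g P2 α p r q / (1 - α)) - 1)

def f3 (g : Gains) (P2 α q : ℝ) : ℝ := (1 - α) / α * cap (g.g10 ^ 2 * a5 g P2 α q)

/-- The function of `ρ13` whose root is sought in decode-forward. -/
def f4 (g : Gains) (P1 P2 α q : ℝ) : ℝ :=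
  (P1 - (1 - α) * q) / α
    - (g.g10 ^ 2)⁻¹ *
      ((1 - g.g12 ^ 2 / g.g10 ^ 2) / ((2 : ℝ) ^ f3 g P2 α q - g.g12 ^ 2 / g.g10 ^ 2) - 1)

/-! ### The four cases for `g12 ≥ g10` -/

/-- `S₄` has a positive multiplier, `ρ10 ≥ 0` does not. -/
def Case2a (m : Multipliers) : Prop := 0 < m.lam1 ∧ m.mu10 = 0

/-- `S₄` and `ρ10 ≥ 0` have positive multipliers. -/
def Case2b (m : Multipliers) : Prop := 0 < m.lam1 ∧ 0 < m.mu10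

/-- Neither `S₄` nor `ρ10 ≥ 0` has a positive multiplier. -/
def Case3a (m : Multipliers) : Prop := m.lam1 = 0 ∧ m.mu10 = 0

/-- `ρ10 ≥ 0` has a positive multiplier, `S₄` does not. -/
def Case3b (m : Multipliers) : Prop := m.lam1 = 0 ∧ 0 < m.mu10

/-- The assertion for a KKT solution in the first case. -/
def Case2aConclusion (g : Gains) (P1 P2 α : ℝ) (x : Point) (m : Multipliers) : Prop :=
  0 < m.lam0 ∧ x.R = x.J1 g P2 α ∧ x.R = x.S4 g P2 α ∧
  0 < x.ρ13 ∧ f2 g P1 P2 α x.ρ13 = 0 ∧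
  x.ρ11 = rho11Of g P1 P2 α x.ρ13 ∧ x.ρ10 = rho10Of g P2 α x.ρ11 x.ρ13 ∧
  (0 < x.ρ10 → UsesScheme g (relayDesign P2 α x) x.R IsPDFRepetition) ∧
  (x.ρ10 = 0 → UsesScheme g (relayDesign P2 α x) x.R IsDF)

/-- The assertion for a KKT solution in the second case. -/
def Case2bConclusion (g : Gains) (P1 P2 α : ℝ) (x : Point) (m : Multipliers) : Prop :=
  x.R = x.S4 g P2 α ∧ x.ρ10 = 0 ∧ 0 < x.ρ13 ∧ x.ρ11 = α⁻¹ * (P1 - (1 - α) * x.ρ13) ∧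
  (0 < m.lam0 → x.R = x.J1 g P2 α ∧ f4 g P1 P2 α x.ρ13 = 0) ∧
  (m.lam0 = 0 →
    a4 g P2 α x.ρ13 * a2 g x.ρ11 = (g.g10 ^ 2)⁻¹ + a5 g P2 α x.ρ13) ∧
  UsesScheme g (relayDesign P2 α x) x.R IsDF

/-- The assertion for a KKT solution in the third case. -/
def Case3aConclusion (g : Gains) (P1 P2 α : ℝ) (x : Point) (m : Multipliers) : Prop :=
  0 < m.lam0 ∧ 0 < m.mu13 ∧ x.R = x.J1 g P2 α ∧
  x.ρ13 = 0 ∧ x.ρ11 = P1 + (1 - α) * a1 g ∧ x.ρ10 = P1 - α * a1 g ∧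
  (0 < x.ρ10 → UsesScheme g (relayDesign P2 α x) x.R IsPDFNoRepetition) ∧
  (x.ρ10 = 0 → UsesScheme g (relayDesign P2 α x) x.R IsTwoHop)

/-- The assertion for a KKT solution in the fourth case. -/
def Case3bConclusion (g : Gains) (P1 P2 α : ℝ) (x : Point) (m : Multipliers) : Prop :=
  0 < m.lam0 ∧ 0 < m.mu13 ∧ x.R = x.J1 g P2 α ∧
  x.ρ13 = 0 ∧ x.ρ10 = 0 ∧ x.ρ11 = P1 / α ∧
  UsesScheme g (relayDesign P2 α x) x.R IsTwoHop

end

end RelayMAC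

open RelayMAC

/-!
As functions of the power vector `(ρ10, ρ11, ρ13)` the bounds `J₁` and `S₄` are concave, and on the
simplex of valid power allocations they are strictly concave, so their minimum has exactly one
maximizer. A maximizer of the minimum of two concave functions maximizes some convex combination
`λ₀ J₁ + λ₁ S₄`; its gradient at the maximizer gives the remaining multipliers. Differentiability
fails only at `ρ13 = 0`, where `S₄` grows like `√ρ13`: hence `λ₁ > 0` forces `ρ13 > 0`, and the four
cases are read off from the stationarity equations. Conversely, the Lagrangian is concave, so a KKT
point is optimal.

Spreading the power of phase 3 over phases 2 and 3, with user 2 silent in phase 2, does not decrease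
`J₁` and `S₄`, by Jensen's inequality for `C`. This reduces the three-phase scheme to the relay
problem. If `g12 < g10`, Jensen's inequality also gives `J₁ ≤ C(g10² P₁)`, and strict concavity
leaves direct transmission as the only case of equality.
-/

namespace RelayMAC

/-! ### Strict concavity of composites -/

section Concavity

variable {E : Type*} [AddCommGroup E] [Module ℝ E] {s : Set E} {t : Set ℝ} {f : E → ℝ}
  {φ : ℝ → ℝ}

theorem concaveOn_comp_of_mapsTo (hφ : ConcaveOn ℝ t φ) (hφ' : MonotoneOn φ t)
    (hf : ConcaveOn ℝ s f) (hst : Set.MapsTo f s t) : ConcaveOn ℝ s fun x => φ (f x) :=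
  ⟨hf.1, fun _ hx _ hy _ _ ha hb hab =>
    (hφ.2 (hst hx) (hst hy) ha hb hab).trans
      (hφ' (hφ.1 (hst hx) (hst hy) ha hb hab) (hst (hf.1 hx hy ha hb hab))
        (hf.2 hx hy ha hb hab))⟩

theorem strictConcaveOn_comp_of_mapsTo (hφ : ConcaveOn ℝ t φ) (hφ' : StrictMonoOn φ t)
    (hf : StrictConcaveOn ℝ s f) (hst : Set.MapsTo f s t) :
    StrictConcaveOn ℝ s fun x => φ (f x) :=
  ⟨hf.1, fun _ hx _ hy hxy _ _ ha hb hab =>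
    (hφ.2 (hst hx) (hst hy) ha.le hb.le hab).trans_lt
      (hφ' (hφ.1 (hst hx) (hst hy) ha.le hb.le hab) (hst (hf.1 hx hy ha.le hb.le hab))
        (hf.2 hx hy hxy ha hb hab))⟩

theorem strictConcaveOn_comp_linearMap_of_injOn (hφ : StrictConcaveOn ℝ t φ) (ℓ : E →ₗ[ℝ] ℝ)
    (hs : Convex ℝ s) (hst : Set.MapsTo ℓ s t) (hℓ : Set.InjOn ℓ s) :
    StrictConcaveOn ℝ s fun x => φ (ℓ x) := by
  refine ⟨hs, fun x hx y hy hxy a b ha hb hab => ?_⟩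
  simp only [map_add, map_smul]
  exact hφ.2 (hst hx) (hst hy) (hℓ.ne hx hy hxy) ha hb hab

theorem strictConcaveOn_const_mul {c : ℝ} (hc : 0 < c) (hf : StrictConcaveOn ℝ s f) :
    StrictConcaveOn ℝ s fun x => c * f x := by
  refine ⟨hf.1, fun x hx y hy hxy a b ha hb hab => ?_⟩
  have h := mul_lt_mul_of_pos_left (hf.2 hx hy hxy ha hb hab) hc
  simp only [smul_eq_mul] at h ⊢
  linarith

theorem strictConcaveOn_comp_linearMap_add {ψ : E → ℝ} (hφ : StrictConcaveOn ℝ t φ)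
    (ℓ : E →ₗ[ℝ] ℝ) (hst : Set.MapsTo ℓ s t) (hψ : ConcaveOn ℝ s ψ)
    (hfiber : ∀ c, StrictConcaveOn ℝ (s ∩ ℓ ⁻¹' {c}) ψ) :
    StrictConcaveOn ℝ s fun x => φ (ℓ x) + ψ x := by
  refine ⟨hψ.1, fun x hx y hy hxy a b ha hb hab => ?_⟩
  simp only [map_add, map_smul, smul_add]
  rw [add_add_add_comm]
  by_cases h : ℓ x = ℓ y
  · exact add_lt_add_of_le_of_lt (hφ.concaveOn.2 (hst hx) (hst hy) ha.le hb.le hab)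
      ((hfiber (ℓ y)).2 ⟨hx, h⟩ ⟨hy, rfl⟩ hxy ha hb hab)
  · exact add_lt_add_of_lt_of_le (hφ.2 (hst hx) (hst hy) h ha hb hab)
      (hψ.2 hx hy ha.le hb.le hab)

end Concavity

/-! ### The capacity function -/

section Capacity

variable {a b γ x y t : ℝ}

theorem cap_zero : cap 0 = 0 := by simp [cap]

theorem strictMonoOn_cap : StrictMonoOn cap (Set.Ici 0) := by
  intro x (hx : 0 ≤ x) y _ hxy
  exact Real.logb_lt_logb one_lt_two (by linarith) (by linarith)

theorem cap_lt_cap (hx : 0 ≤ x) (hxy : x < y) : cap x < cap y :=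
  strictMonoOn_cap hx (hx.trans hxy.le) hxy

theorem cap_le_cap (hx : 0 ≤ x) (hxy : x ≤ y) : cap x ≤ cap y :=
  strictMonoOn_cap.monotoneOn hx (hx.trans hxy) hxy

theorem cap_nonneg (hx : 0 ≤ x) : 0 ≤ cap x := by
  simpa only [cap_zero] using cap_le_cap le_rfl hx

theorem cap_pos (hx : 0 < x) : 0 < cap x := by
  simpa only [cap_zero] using cap_lt_cap le_rfl hx

theorem two_rpow_cap (hx : 0 ≤ x) : (2 : ℝ) ^ cap x = 1 + x :=
  Real.rpow_logb two_pos (by norm_num) (by linarith)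

theorem hasDerivAt_cap (hx : 0 ≤ x) : HasDerivAt cap (1 / ((1 + x) * Real.log 2)) x := by
  rw [← div_div]
  exact (((hasDerivAt_id x).const_add 1).log (by simp only [id]; linarith)).div_const _

theorem continuousOn_cap : ContinuousOn cap (Set.Ici 0) :=
  fun _ hx => (hasDerivAt_cap hx).continuousAt.continuousWithinAt

theorem strictConcaveOn_cap : StrictConcaveOn ℝ (Set.Ici 0) cap := by
  have hlog := (strictConcaveOn_log_Ioi.translate_right 1).subset
    (fun x (hx : 0 ≤ x) => show 0 < 1 + x by linarith) (convex_Ici 0)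
  refine (strictConcaveOn_const_mul (inv_pos.2 (Real.log_pos one_lt_two)) hlog).congr
    fun x _ => ?_
  simp only [cap, Real.logb, Function.comp_apply]
  ring

theorem mul_cap_add_mul_cap_le (ha : 0 ≤ a) (hb : 0 ≤ b) (hab : a + b ≤ 1) (hx : 0 ≤ x)
    (hy : 0 ≤ y) : a * cap x + b * cap y ≤ cap (a * x + b * y) := by
  have h := strictConcaveOn_cap.concaveOn.le_map_sum (t := Finset.univ)
    (w := ![a, b, 1 - (a + b)]) (p := ![x, y, 0])
    (by simp [Fin.forall_fin_succ, ha, hb, hab]) (by simp [Fin.sum_univ_three])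
    (by simp [Fin.forall_fin_succ, hx, hy])
  simpa [Fin.sum_univ_three, cap_zero] using h

theorem mul_cap_add_mul_cap_le_mul_cap_div (ha : 0 ≤ a) (hb : 0 ≤ b) (hab : 0 < a + b)
    (hx : 0 ≤ x) (hy : 0 ≤ y) :
    a * cap x + b * cap y ≤ (a + b) * cap ((a * x + b * y) / (a + b)) := by
  have h := mul_cap_add_mul_cap_le (div_nonneg ha hab.le) (div_nonneg hb hab.le)
    (add_div a b _ ▸ div_self hab.ne' |>.le) hx hy
  calc a * cap x + b * cap y
      = (a + b) * (a / (a + b) * cap x + b / (a + b) * cap y) := by field_simp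
    _ ≤ (a + b) * cap (a / (a + b) * x + b / (a + b) * y) := by gcongr
    _ = (a + b) * cap ((a * x + b * y) / (a + b)) := by congr 2; ring

theorem mul_cap_lt (ha : 0 < a) (ha1 : a < 1) (hx : 0 < x) : a * cap x < cap (a * x) := by
  simpa [cap_zero] using
    strictConcaveOn_cap.2 hx.le (Set.mem_Ici.2 le_rfl) hx.ne' ha (sub_pos.2 ha1) (by ring)

theorem strictMonoOn_cap_sq_mul (hγ : 0 < γ) :
    StrictMonoOn (fun t => cap (γ ^ 2 * t)) (Set.Ici 0) :=
  fun _ hx _ _ hxy => cap_lt_cap (mul_nonneg (sq_nonneg γ) hx)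
    (mul_lt_mul_of_pos_left hxy (pow_pos hγ 2))

theorem strictConcaveOn_cap_sq_mul (hγ : 0 < γ) :
    StrictConcaveOn ℝ (Set.Ici 0) fun t => cap (γ ^ 2 * t) :=
  strictConcaveOn_comp_linearMap_of_injOn strictConcaveOn_cap (LinearMap.mulLeft ℝ (γ ^ 2))
    (convex_Ici 0) (fun _ ht => mul_nonneg (sq_nonneg γ) ht)
    (mul_right_injective₀ (pow_pos hγ 2).ne').injOn

theorem hasDerivAt_cap_sq_mul (hγ : 0 < γ) (ht : 0 ≤ t) :
    HasDerivAt (fun t => cap (γ ^ 2 * t)) (1 / (((γ ^ 2)⁻¹ + t) * Real.log 2)) t := by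
  have h := (hasDerivAt_cap (mul_nonneg (sq_nonneg γ) ht)).comp t (hasDerivAt_const_mul (γ ^ 2))
  refine h.congr_deriv ?_
  have : 0 < Real.log 2 := Real.log_pos one_lt_two
  field_simp

end Capacity

/-! ### The rate bounds as functions of the power vector -/

/-- `ζ / g10²` in the relay problem, as a function of `v = (ρ10, ρ11, ρ13)`. -/
noncomputable def effPower (g : Gains) (P2 α : ℝ) (v : ℝ × ℝ × ℝ) : ℝ := v.1 + a5 g P2 α v.2.2

/-- `J₁` in the relay problem, as a function of `v = (ρ10, ρ11, ρ13)`. -/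
noncomputable def relayJ (g : Gains) (α : ℝ) (v : ℝ × ℝ × ℝ) : ℝ :=
  α * cap (g.g12 ^ 2 * v.2.1) + (1 - α) * cap (g.g10 ^ 2 * v.1)

/-- `S₄` in the relay problem, as a function of `v = (ρ10, ρ11, ρ13)`. -/
noncomputable def relayS (g : Gains) (P2 α : ℝ) (v : ℝ × ℝ × ℝ) : ℝ :=
  α * cap (g.g10 ^ 2 * v.2.1) + (1 - α) * cap (g.g10 ^ 2 * effPower g P2 α v)

/-- The combination `l0 J₁ + l1 S₄` to which the multipliers of the two rate bounds reduce the
relay problem. -/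
noncomputable def weightedRate (g : Gains) (P2 α l0 l1 : ℝ) (v : ℝ × ℝ × ℝ) : ℝ :=
  l0 * relayJ g α v + l1 * relayS g P2 α v

/-- The valid power allocations `(ρ10, ρ11, ρ13)` of the relay problem. -/
def powerSimplex (P1 α : ℝ) : Set (ℝ × ℝ × ℝ) :=
  {v | 0 ≤ v ∧ α * v.2.1 + (1 - α) * (v.1 + v.2.2) = P1}

/-- The power vector `(ρ10, ρ11, ρ13)` of a point of the relay problem. -/
def Point.powers (x : Point) : ℝ × ℝ × ℝ := (x.ρ10, x.ρ11, x.ρ13)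

variable {g : Gains} {P1 P2 α q l0 l1 : ℝ} {v : ℝ × ℝ × ℝ} {x : Point}

theorem Point.J1_eq (g : Gains) (P2 α : ℝ) (x : Point) : x.J1 g P2 α = relayJ g α x.powers := by
  simp [Point.J1, Design.J1, Design.I1, Design.I3, Design.α3, relayDesign, relayJ, Point.powers]

theorem zeta_relayDesign (hg : g.Pos) (P2 α : ℝ) (x : Point) :
    (relayDesign P2 α x).ζ g = g.g10 ^ 2 * effPower g P2 α x.powers := by
  have := hg.2.2.1
  simp only [Design.ζ, relayDesign, effPower, a5, Point.powers]
  field_simp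
  ring

theorem Point.S4_eq (hg : g.Pos) (P2 α : ℝ) (x : Point) :
    x.S4 g P2 α = relayS g P2 α x.powers := by
  simp only [Point.S4, Design.S4, Design.I8, zeta_relayDesign hg]
  simp [relayS, relayDesign, Design.α3, Point.powers]

theorem Point.validPower_iff : x.ValidPower P1 α ↔ x.powers ∈ powerSimplex P1 α :=
  and_comm

theorem Point.feasible_iff (hg : g.Pos) :
    x.Feasible g P1 P2 α ↔ x.powers ∈ powerSimplex P1 α ∧ x.R ≤ relayJ g α x.powers ∧
      x.R ≤ relayS g P2 α x.powers := by
  rw [Point.Feasible, Point.validPower_iff, Point.J1_eq, Point.S4_eq hg]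

theorem rho23_pos (hP2 : 0 < P2) (hα : α < 1) : 0 < rho23 P2 α :=
  div_pos hP2 (sub_pos.2 hα)

theorem lt_a5 (hg : g.Pos) (hP2 : 0 < P2) (hα : α < 1) (q : ℝ) : q < a5 g P2 α q := by
  have hρ := rho23_pos hP2 hα
  obtain ⟨-, -, h10, h20⟩ := hg
  rw [a5, add_assoc]
  exact lt_add_of_pos_right _ (by positivity)

theorem a5_pos (hg : g.Pos) (hP2 : 0 < P2) (hα : α < 1) (hq : 0 ≤ q) : 0 < a5 g P2 α q :=
  hq.trans_lt (lt_a5 hg hP2 hα q)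

theorem effPower_pos (hg : g.Pos) (hP2 : 0 < P2) (hα : α < 1) (hv : 0 ≤ v) :
    0 < effPower g P2 α v :=
  add_pos_of_nonneg_of_pos hv.1 (a5_pos hg hP2 hα hv.2.2)

theorem lt_effPower (hg : g.Pos) (hP2 : 0 < P2) (hα : α < 1) (hv : 0 ≤ v) :
    v.1 < effPower g P2 α v :=
  lt_add_of_pos_right _ (a5_pos hg hP2 hα hv.2.2)

theorem continuous_effPower (g : Gains) (P2 α : ℝ) : Continuous (effPower g P2 α) := by
  unfold effPower a5
  fun_prop

theorem strictConcaveOn_a5 (hg : g.Pos) (hP2 : 0 < P2) (hα : α < 1) :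
    StrictConcaveOn ℝ (Set.Ici 0) (a5 g P2 α) := by
  have hρ := rho23_pos hP2 hα
  obtain ⟨-, -, h10, h20⟩ := hg
  have hlin : ConcaveOn ℝ (Set.Ici 0) fun q => q + g.g20 ^ 2 / g.g10 ^ 2 * rho23 P2 α :=
    (concaveOn_id (convex_Ici 0)).add_const _
  refine (hlin.add_strictConcaveOn (strictConcaveOn_const_mul
    (c := 2 * (g.g20 / g.g10) * √(rho23 P2 α)) (by positivity)
    Real.strictConcaveOn_sqrt)).congr fun q _ => ?_
  simp only [Pi.add_apply, a5, Real.sqrt_mul' _ hρ.le]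
  ring

/-! ### Concavity of the rate bounds -/

theorem convex_powerSimplex (P1 α : ℝ) : Convex ℝ (powerSimplex P1 α) := by
  rintro x ⟨hx, hxP⟩ y ⟨hy, hyP⟩ a b ha hb hab
  refine ⟨convex_Ici (0 : ℝ × ℝ × ℝ) hx hy ha hb hab, ?_⟩
  simp only [Prod.fst_add, Prod.snd_add, Prod.smul_fst, Prod.smul_snd, smul_eq_mul]
  linear_combination a * hxP + b * hyP + P1 * hab

theorem concaveOn_effPower (hg : g.Pos) (hP2 : 0 < P2) (hα : α < 1) :
    ConcaveOn ℝ (Set.Ici 0) (effPower g P2 α) :=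
  ((LinearMap.fst ℝ ℝ (ℝ × ℝ)).concaveOn (convex_Ici 0)).add
    (((strictConcaveOn_a5 hg hP2 hα).concaveOn.comp_linearMap
      (LinearMap.snd ℝ ℝ ℝ ∘ₗ LinearMap.snd ℝ ℝ (ℝ × ℝ))).subset (fun _ hv => hv.2.2)
        (convex_Ici 0))

theorem concaveOn_cap_effPower (hg : g.Pos) (hP2 : 0 < P2) (hα : α < 1) :
    ConcaveOn ℝ (Set.Ici 0) fun v => cap (g.g10 ^ 2 * effPower g P2 α v) :=
  concaveOn_comp_of_mapsTo (φ := fun t => cap (g.g10 ^ 2 * t))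
    (strictConcaveOn_cap_sq_mul hg.2.2.1).concaveOn
    (strictMonoOn_cap_sq_mul hg.2.2.1).monotoneOn (concaveOn_effPower hg hP2 hα)
    fun _ hv => (effPower_pos hg hP2 hα hv).le

theorem concaveOn_cap_comp_linearMap {γ : ℝ} (hγ : 0 < γ) {ℓ : ℝ × ℝ × ℝ →ₗ[ℝ] ℝ}
    (hℓ : Set.MapsTo ℓ (Set.Ici 0) (Set.Ici 0)) :
    ConcaveOn ℝ (Set.Ici 0) fun v => cap (γ ^ 2 * ℓ v) :=
  ((strictConcaveOn_cap_sq_mul hγ).concaveOn.comp_linearMap ℓ).subset hℓ (convex_Ici 0)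

theorem concaveOn_relayJ (hg : g.Pos) (hα0 : 0 ≤ α) (hα : α ≤ 1) :
    ConcaveOn ℝ (Set.Ici 0) (relayJ g α) :=
  ((concaveOn_cap_comp_linearMap hg.1
    (ℓ := LinearMap.fst ℝ ℝ ℝ ∘ₗ LinearMap.snd ℝ ℝ (ℝ × ℝ)) fun _ hv => hv.2.1).smul hα0).add
    ((concaveOn_cap_comp_linearMap hg.2.2.1
      (ℓ := LinearMap.fst ℝ ℝ (ℝ × ℝ)) fun _ hv => hv.1).smul (sub_nonneg.2 hα))

theorem concaveOn_relayS (hg : g.Pos) (hP2 : 0 < P2) (hα0 : 0 ≤ α) (hα : α < 1) :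
    ConcaveOn ℝ (Set.Ici 0) (relayS g P2 α) :=
  ((concaveOn_cap_comp_linearMap hg.2.2.1
    (ℓ := LinearMap.fst ℝ ℝ ℝ ∘ₗ LinearMap.snd ℝ ℝ (ℝ × ℝ)) fun _ hv => hv.2.1).smul hα0).add
    ((concaveOn_cap_effPower hg hP2 hα).smul (sub_nonneg.2 hα.le))

theorem concaveOn_weightedRate (hg : g.Pos) (hP2 : 0 < P2) (hα0 : 0 ≤ α) (hα : α < 1)
    (hl0 : 0 ≤ l0) (hl1 : 0 ≤ l1) : ConcaveOn ℝ (Set.Ici 0) (weightedRate g P2 α l0 l1) :=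
  ((concaveOn_relayJ hg hα0 hα.le).smul hl0).add ((concaveOn_relayS hg hP2 hα0 hα).smul hl1)

theorem injOn_fst_powerSimplex_fiber (P1 : ℝ) (hα : α < 1) (r : ℝ) :
    Set.InjOn (fun v : ℝ × ℝ × ℝ => v.1) (powerSimplex P1 α ∩ {v | v.2.1 = r}) := by
  rintro ⟨p, r, q⟩ ⟨⟨-, hv⟩, rfl⟩ ⟨p', r', q'⟩ ⟨⟨-, hw⟩, rfl : r' = r⟩ (rfl : p = p')
  have hq : (1 - α) * q = (1 - α) * q' := by linear_combination hv - hw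
  rw [mul_left_cancel₀ (sub_pos.2 hα).ne' hq]

theorem injOn_thd_powerSimplex_fiber (P1 : ℝ) (hα : α < 1) (r : ℝ) :
    Set.InjOn (fun v : ℝ × ℝ × ℝ => v.2.2) (powerSimplex P1 α ∩ {v | v.2.1 = r}) := by
  rintro ⟨p, r, q⟩ ⟨⟨-, hv⟩, rfl⟩ ⟨p', r', q'⟩ ⟨⟨-, hw⟩, rfl : r' = r⟩ (rfl : q = q')
  have hp : (1 - α) * p = (1 - α) * p' := by linear_combination hv - hw
  rw [mul_left_cancel₀ (sub_pos.2 hα).ne' hp]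

theorem convex_powerSimplex_fiber (P1 α r : ℝ) :
    Convex ℝ (powerSimplex P1 α ∩ {v | v.2.1 = r}) :=
  (convex_powerSimplex P1 α).inter ((convex_singleton r).linear_preimage
    (LinearMap.fst ℝ ℝ ℝ ∘ₗ LinearMap.snd ℝ ℝ (ℝ × ℝ)))

theorem strictConcaveOn_relayJ (hg : g.Pos) (P1 : ℝ) (hα0 : 0 < α) (hα : α < 1) :
    StrictConcaveOn ℝ (powerSimplex P1 α) (relayJ g α) :=
  have hsub : powerSimplex P1 α ⊆ Set.Ici 0 := fun _ hv => hv.1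
  strictConcaveOn_comp_linearMap_add
    (strictConcaveOn_const_mul hα0 (strictConcaveOn_cap_sq_mul hg.1))
    (LinearMap.fst ℝ ℝ ℝ ∘ₗ LinearMap.snd ℝ ℝ (ℝ × ℝ)) (fun _ hv => hv.1.2.1)
    (((concaveOn_cap_comp_linearMap hg.2.2.1 (ℓ := LinearMap.fst ℝ ℝ (ℝ × ℝ))
      fun _ hv => hv.1).smul (sub_nonneg.2 hα.le)).subset hsub (convex_powerSimplex P1 α))
    fun r => strictConcaveOn_const_mul (sub_pos.2 hα)
      (strictConcaveOn_comp_linearMap_of_injOn (strictConcaveOn_cap_sq_mul hg.2.2.1)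
        (LinearMap.fst ℝ ℝ (ℝ × ℝ)) (convex_powerSimplex_fiber P1 α r) (fun _ hv => hv.1.1.1)
        (injOn_fst_powerSimplex_fiber P1 hα r))

theorem strictConcaveOn_effPower_fiber (hg : g.Pos) (P1 : ℝ) (hP2 : 0 < P2) (hα : α < 1)
    (r : ℝ) :
    StrictConcaveOn ℝ (powerSimplex P1 α ∩ {v | v.2.1 = r}) (effPower g P2 α) :=
  ((LinearMap.fst ℝ ℝ (ℝ × ℝ)).concaveOn (convex_powerSimplex_fiber P1 α r)).add_strictConcaveOn
    (strictConcaveOn_comp_linearMap_of_injOn (strictConcaveOn_a5 hg hP2 hα)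
      (LinearMap.snd ℝ ℝ ℝ ∘ₗ LinearMap.snd ℝ ℝ (ℝ × ℝ)) (convex_powerSimplex_fiber P1 α r)
      (fun _ hv => hv.1.1.2.2) (injOn_thd_powerSimplex_fiber P1 hα r))

theorem strictConcaveOn_relayS (hg : g.Pos) (P1 : ℝ) (hP2 : 0 < P2) (hα0 : 0 < α) (hα : α < 1) :
    StrictConcaveOn ℝ (powerSimplex P1 α) (relayS g P2 α) :=
  have hsub : powerSimplex P1 α ⊆ Set.Ici 0 := fun _ hv => hv.1
  have hcap := strictConcaveOn_cap_sq_mul hg.2.2.1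
  strictConcaveOn_comp_linearMap_add (strictConcaveOn_const_mul hα0 hcap)
    (LinearMap.fst ℝ ℝ ℝ ∘ₗ LinearMap.snd ℝ ℝ (ℝ × ℝ)) (fun _ hv => hv.1.2.1)
    (((concaveOn_cap_effPower hg hP2 hα).smul (sub_nonneg.2 hα.le)).subset hsub
      (convex_powerSimplex P1 α))
    fun r => strictConcaveOn_const_mul (sub_pos.2 hα)
      (strictConcaveOn_comp_of_mapsTo (φ := fun t => cap (g.g10 ^ 2 * t)) hcap.concaveOn
        (strictMonoOn_cap_sq_mul hg.2.2.1) (strictConcaveOn_effPower_fiber hg P1 hP2 hα r)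
        fun _ hv => (effPower_pos hg hP2 hα hv.1.1).le)

/-! ### Existence and uniqueness of the solution -/

theorem continuousOn_relayJ (g : Gains) (α : ℝ) : ContinuousOn (relayJ g α) (Set.Ici 0) := by
  refine (continuousOn_const.mul (continuousOn_cap.comp (by fun_prop) fun v hv => ?_)).add
    (continuousOn_const.mul (continuousOn_cap.comp (by fun_prop) fun v hv => ?_))
  · exact mul_nonneg (sq_nonneg _) hv.2.1
  · exact mul_nonneg (sq_nonneg _) hv.1

theorem continuousOn_relayS (hg : g.Pos) (hP2 : 0 < P2) (hα : α < 1) :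
    ContinuousOn (relayS g P2 α) (Set.Ici 0) := by
  have := continuous_effPower g P2 α
  refine (continuousOn_const.mul (continuousOn_cap.comp (by fun_prop) fun v hv => ?_)).add
    (continuousOn_const.mul (continuousOn_cap.comp (by fun_prop) fun v hv => ?_))
  · exact mul_nonneg (sq_nonneg _) hv.2.1
  · exact mul_nonneg (sq_nonneg _) (effPower_pos hg hP2 hα hv).le

theorem isCompact_powerSimplex (P1 : ℝ) (hα0 : 0 < α) (hα : α < 1) :
    IsCompact (powerSimplex P1 α) := by
  have hβ := sub_pos.2 hα
  refine isCompact_Icc (a := (0 : ℝ × ℝ × ℝ)) (b := (P1 / (1 - α), P1 / α, P1 / (1 - α)))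
    |>.of_isClosed_subset (isClosed_Ici.inter (isClosed_eq (by fun_prop) (by fun_prop))) ?_
  rintro ⟨p, r, q⟩ ⟨hv, hP : α * r + (1 - α) * (p + q) = P1⟩
  have hp := mul_nonneg hβ.le hv.1
  have hr := mul_nonneg hα0.le hv.2.1
  have hq := mul_nonneg hβ.le hv.2.2
  refine ⟨hv, (le_div_iff₀ hβ).2 ?_, (le_div_iff₀ hα0).2 ?_, (le_div_iff₀ hβ).2 ?_⟩ <;>
    simp only at hp hr hq ⊢ <;> linarith

theorem vertex_fst_mem (hP1 : 0 ≤ P1) (hα : α < 1) :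
    ((P1 / (1 - α), 0, 0) : ℝ × ℝ × ℝ) ∈ powerSimplex P1 α := by
  have hβ := sub_pos.2 hα
  refine ⟨⟨by positivity, le_rfl, le_rfl⟩, ?_⟩
  simp [mul_div_cancel₀ _ hβ.ne']

theorem vertex_snd_mem (hP1 : 0 ≤ P1) (hα : 0 < α) :
    ((0, P1 / α, 0) : ℝ × ℝ × ℝ) ∈ powerSimplex P1 α := by
  refine ⟨⟨le_rfl, by positivity, le_rfl⟩, ?_⟩
  simp [mul_div_cancel₀ _ hα.ne']

theorem vertex_thd_mem (hP1 : 0 ≤ P1) (hα : α < 1) :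
    ((0, 0, P1 / (1 - α)) : ℝ × ℝ × ℝ) ∈ powerSimplex P1 α := by
  have hβ := sub_pos.2 hα
  refine ⟨⟨le_rfl, le_rfl, by positivity⟩, ?_⟩
  simp [mul_div_cancel₀ _ hβ.ne']

theorem isOptimal_iff (hg : g.Pos) :
    IsOptimal g P1 P2 α x ↔ x.powers ∈ powerSimplex P1 α ∧
      IsMaxOn (relayJ g α ⊓ relayS g P2 α) (powerSimplex P1 α) x.powers ∧
      x.R = (relayJ g α ⊓ relayS g P2 α) x.powers := by
  simp only [IsOptimal, Point.feasible_iff hg]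
  constructor
  · rintro ⟨⟨hx, hJ, hS⟩, hmax⟩
    have hle : ∀ v ∈ powerSimplex P1 α, (relayJ g α ⊓ relayS g P2 α) v ≤ x.R := fun v hv =>
      hmax ⟨(relayJ g α ⊓ relayS g P2 α) v, v.1, v.2.1, v.2.2⟩ ⟨hv, inf_le_left, inf_le_right⟩
    have hR : x.R = (relayJ g α ⊓ relayS g P2 α) x.powers :=
      le_antisymm (le_inf hJ hS) (hle _ hx)
    exact ⟨hx, fun v hv => (hle v hv).trans_eq hR, hR⟩
  · rintro ⟨hx, hmax, hR⟩
    exact ⟨⟨hx, hR.trans_le inf_le_left, hR.trans_le inf_le_right⟩,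
      fun y hy => (le_inf hy.2.1 hy.2.2).trans ((hmax hy.1).trans_eq hR.symm)⟩

theorem existsUnique_isOptimal (hg : g.Pos) (hP1 : 0 ≤ P1) (hP2 : 0 < P2) (hα0 : 0 < α)
    (hα : α < 1) : ∃! x : Point, IsOptimal g P1 P2 α x := by
  have hcont : ContinuousOn (relayJ g α ⊓ relayS g P2 α) (powerSimplex P1 α) :=
    ((continuousOn_relayJ g α).inf (continuousOn_relayS hg hP2 hα)).mono fun _ h => h.1
  obtain ⟨v, hv, hmax⟩ := (isCompact_powerSimplex P1 hα0 hα).exists_isMaxOn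
    ⟨_, vertex_fst_mem hP1 hα⟩ hcont
  refine ⟨⟨(relayJ g α ⊓ relayS g P2 α) v, v.1, v.2.1, v.2.2⟩,
    (isOptimal_iff hg).2 ⟨hv, hmax, rfl⟩, fun y hy => ?_⟩
  obtain ⟨hy, hymax, hyR⟩ := (isOptimal_iff hg).1 hy
  obtain rfl : y.powers = v := ((strictConcaveOn_relayJ hg P1 hα0 hα).inf
    (strictConcaveOn_relayS hg P1 hP2 hα0 hα)).eq_of_isMaxOn hymax hmax hy hv
  rw [← hyR]
  rfl

/-! ### Maxima of concave functions -/

theorem isMaxOn_of_concaveOn_of_hasFDerivAt_zero {E : Type*} [NormedAddCommGroup E]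
    [NormedSpace ℝ E] {s : Set E} {f : E → ℝ} {x : E} (hf : ConcaveOn ℝ s f) (hx : x ∈ s)
    (h : HasFDerivAt f (0 : E →L[ℝ] ℝ) x) : IsMaxOn f s x := by
  intro y hy
  have hline : ConcaveOn ℝ (AffineMap.lineMap x y ⁻¹' s) (f ∘ AffineMap.lineMap (k := ℝ) x y) :=
    hf.comp_affineMap _
  have h0 : HasFDerivAt f (0 : E →L[ℝ] ℝ) (AffineMap.lineMap (k := ℝ) x y 0) := by simpa using h
  have hderiv : HasDerivAt (f ∘ AffineMap.lineMap (k := ℝ) x y) 0 0 := by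
    simpa using h0.comp_hasDerivAt (0 : ℝ) AffineMap.hasDerivAt_lineMap
  simpa [slope_def_field] using hline.slope_le_of_hasDerivAt (x := 0) (y := 1)
    (by simpa using hx) (by simpa using hy) zero_lt_one hderiv

theorem isMaxOn_hasFDerivAt {E : Type*} [NormedAddCommGroup E] [NormedSpace ℝ E] {s : Set E}
    {f : E → ℝ} {D : E →L[ℝ] ℝ} {x : E} (hs : Convex ℝ s) (hx : x ∈ s) (hmax : IsMaxOn f s x)
    (hD : HasFDerivAt f D x) : IsMaxOn D s x := by
  intro y hy
  have := hmax.localize.hasFDerivWithinAt_nonpos hD.hasFDerivWithinAt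
    (sub_mem_posTangentConeAt_of_segment_subset (hs.segment_subset hx hy))
  rwa [map_sub, sub_nonpos] at this

theorem exists_convexCombination_le {E : Type*} [TopologicalSpace E] [AddCommGroup E] [Module ℝ E]
    [IsTopologicalAddGroup E] [ContinuousSMul ℝ E] {s : Set E} {f₀ f₁ : E → ℝ} {R : ℝ}
    (hs : IsCompact s) (hne : s.Nonempty) (h₀ : ConcaveOn ℝ s f₀) (h₁ : ConcaveOn ℝ s f₁)
    (hc₀ : ContinuousOn f₀ s) (hc₁ : ContinuousOn f₁ s) (hR : ∀ x ∈ s, (f₀ ⊓ f₁) x ≤ R) :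
    ∃ l₀ l₁ : ℝ, 0 ≤ l₀ ∧ 0 ≤ l₁ ∧ l₀ + l₁ = 1 ∧ ∀ x ∈ s, l₀ * f₀ x + l₁ * f₁ x ≤ R := by
  have haffine (x : E) : ConvexOn ℝ (Set.Icc 0 1) fun l => (1 - l) * f₀ x + l * f₁ x :=
    ⟨convex_Icc 0 1, fun _ _ _ _ a b _ _ hab => le_of_eq <| by
      simp only [smul_eq_mul]
      linear_combination -f₀ x * hab⟩
  obtain ⟨l, hl, b, hb, hsaddle⟩ := Sion.exists_isSaddlePointOn (X := Set.Icc (0 : ℝ) 1) (Y := s)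
    (f := fun l x => (1 - l) * f₀ x + l * f₁ x) ⟨0, by simp⟩ (convex_Icc 0 1) isCompact_Icc
    (fun x _ => Continuous.lowerSemicontinuous (by fun_prop) |>.lowerSemicontinuousOn _)
    (fun x _ => (haffine x).quasiconvexOn) h₀.1 hne hs
    (fun l _ => ContinuousOn.upperSemicontinuousOn (by fun_prop))
    (fun l hl => ((h₀.smul (sub_nonneg.2 hl.2)).add (h₁.smul hl.1)).quasiconcaveOn)
  refine ⟨1 - l, l, sub_nonneg.2 hl.2, hl.1, by ring, fun x hx => ?_⟩
  have hx₀ := hsaddle 0 (by simp) x hx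
  have hx₁ := hsaddle 1 (by simp) x hx
  simp only [sub_zero, one_mul, zero_mul, add_zero, sub_self, zero_add] at hx₀ hx₁
  exact (le_inf hx₀ hx₁).trans (hR b hb)

/-! ### Gradients -/

/-- The linear form on power vectors with coefficient vector `c`. -/
noncomputable def linearForm (c : ℝ × ℝ × ℝ) : ℝ × ℝ × ℝ →L[ℝ] ℝ :=
  c.1 • ContinuousLinearMap.fst ℝ ℝ (ℝ × ℝ) +
    (c.2.1 • ContinuousLinearMap.fst ℝ ℝ ℝ + c.2.2 • ContinuousLinearMap.snd ℝ ℝ ℝ).comp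
      (ContinuousLinearMap.snd ℝ ℝ (ℝ × ℝ))

/-- The gradient of `weightedRate` at a point with `ρ13 > 0`. It is also correct for `ρ13 = 0`
when `l1 = 0`. -/
noncomputable def rateGradient (g : Gains) (P2 α l0 l1 : ℝ) (v : ℝ × ℝ × ℝ) : ℝ × ℝ × ℝ :=
  ((1 - α) / Real.log 2 * (l0 / a2 g v.1 + l1 / a2 g (effPower g P2 α v)),
    α / Real.log 2 * (l0 / a3 g v.2.1 + l1 / a2 g v.2.1),
    (1 - α) / Real.log 2 * (l1 / a2 g (effPower g P2 α v) * a4 g P2 α v.2.2))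

/-- The gradient of the power constraints, weighted by their multipliers: the power equality
enters with `lam2`, the sign conditions with `-mu`. -/
def Multipliers.gradient (m : Multipliers) (α : ℝ) : ℝ × ℝ × ℝ :=
  (m.lam2 * (1 - α) - m.mu10, m.lam2 * α - m.mu11, m.lam2 * (1 - α) - m.mu13)

variable {c : ℝ × ℝ × ℝ} {m : Multipliers}

theorem linearForm_apply (c v : ℝ × ℝ × ℝ) :
    linearForm c v = c.1 * v.1 + c.2.1 * v.2.1 + c.2.2 * v.2.2 := by
  simp [linearForm, add_assoc]

theorem linearForm_injective : Function.Injective linearForm := by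
  intro c d h
  have h1 := DFunLike.congr_fun h (1, 0, 0)
  have h2 := DFunLike.congr_fun h (0, 1, 0)
  have h3 := DFunLike.congr_fun h (0, 0, 1)
  simp only [linearForm_apply, mul_one, mul_zero, add_zero, zero_add] at h1 h2 h3
  exact Prod.ext h1 (Prod.ext h2 h3)

theorem a2_pos (hg : g.Pos) {r : ℝ} (hr : 0 ≤ r) : 0 < a2 g r := by
  have := hg.2.2.1
  rw [a2]
  positivity

theorem a3_pos (hg : g.Pos) {r : ℝ} (hr : 0 ≤ r) : 0 < a3 g r := by
  have := hg.1
  rw [a3]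
  positivity

theorem hasDerivAt_a5 (g : Gains) (hP2 : 0 < P2) (hα : α < 1) (hq : 0 < q) :
    HasDerivAt (a5 g P2 α) (a4 g P2 α q) q := by
  have hρ := rho23_pos hP2 hα
  have hsqrt : HasDerivAt (fun q => √(q * rho23 P2 α)) (√(rho23 P2 α / q) / 2) q := by
    refine ((hasDerivAt_mul_const (rho23 P2 α)).sqrt (by positivity)).congr_deriv ?_
    have := Real.sqrt_pos.2 hq
    have := Real.sqrt_pos.2 hρ
    rw [Real.sqrt_mul hq.le, Real.sqrt_div hρ.le]
    field_simp
    rw [Real.sq_sqrt hρ.le]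
  refine (((hasDerivAt_id q).add_const (g.g20 ^ 2 / g.g10 ^ 2 * rho23 P2 α)).add
    (hsqrt.const_mul (2 * (g.g20 / g.g10)))).congr_deriv ?_
  rw [a4]
  ring

theorem hasFDerivAt_relayJ (hg : g.Pos) (hv : 0 ≤ v) (P2 α : ℝ) :
    HasFDerivAt (relayJ g α) (linearForm (rateGradient g P2 α 1 0 v)) v := by
  have hfst : HasFDerivAt (fun v : ℝ × ℝ × ℝ => v.1) (.fst ℝ ℝ (ℝ × ℝ)) v := hasFDerivAt_fst
  have hsnd : HasFDerivAt (fun v : ℝ × ℝ × ℝ => v.2.1) _ v :=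
    (ContinuousLinearMap.fst ℝ ℝ ℝ ∘L .snd ℝ ℝ (ℝ × ℝ)).hasFDerivAt
  have h12 := (hasDerivAt_cap_sq_mul hg.1 hv.2.1).comp_hasFDerivAt v hsnd
  have h10 := (hasDerivAt_cap_sq_mul hg.2.2.1 hv.1).comp_hasFDerivAt v hfst
  refine ((h12.const_mul α).add (h10.const_mul (1 - α))).congr_fderiv ?_
  ext <;> simp [linearForm, rateGradient, a2, a3] <;> ring

theorem hasFDerivAt_relayS (hg : g.Pos) (hP2 : 0 < P2) (hα : α < 1) (hv : 0 ≤ v)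
    (hq : 0 < v.2.2) :
    HasFDerivAt (relayS g P2 α) (linearForm (rateGradient g P2 α 0 1 v)) v := by
  have hfst : HasFDerivAt (fun v : ℝ × ℝ × ℝ => v.1) (.fst ℝ ℝ (ℝ × ℝ)) v := hasFDerivAt_fst
  have hsnd : HasFDerivAt (fun v : ℝ × ℝ × ℝ => v.2.1) _ v :=
    (ContinuousLinearMap.fst ℝ ℝ ℝ ∘L .snd ℝ ℝ (ℝ × ℝ)).hasFDerivAt
  have hthd : HasFDerivAt (fun v : ℝ × ℝ × ℝ => v.2.2) _ v :=
    (ContinuousLinearMap.snd ℝ ℝ ℝ ∘L .snd ℝ ℝ (ℝ × ℝ)).hasFDerivAt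
  have h10 := (hasDerivAt_cap_sq_mul hg.2.2.1 hv.2.1).comp_hasFDerivAt v hsnd
  have h5 := (hasDerivAt_a5 g hP2 hα hq).comp_hasFDerivAt v hthd
  have heff := (hasDerivAt_cap_sq_mul hg.2.2.1 (effPower_pos hg hP2 hα hv).le).comp_hasFDerivAt v
    (hfst.add h5)
  refine ((h10.const_mul α).add (heff.const_mul (1 - α))).congr_fderiv ?_
  ext <;> simp [linearForm, rateGradient, a2] <;> ring

theorem hasFDerivAt_weightedRate (hg : g.Pos) (hP2 : 0 < P2) (hα : α < 1) (hv : 0 ≤ v)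
    (hq : l1 = 0 ∨ 0 < v.2.2) :
    HasFDerivAt (weightedRate g P2 α l0 l1) (linearForm (rateGradient g P2 α l0 l1 v)) v := by
  have hJ := (hasFDerivAt_relayJ hg hv P2 α).const_mul l0
  rcases hq with rfl | hq
  · have h0 : weightedRate g P2 α l0 0 = fun v => l0 * relayJ g α v := by
      ext
      simp [weightedRate]
    rw [h0]
    refine hJ.congr_fderiv ?_
    ext <;> simp [linearForm, rateGradient] <;> ring
  · refine (hJ.add ((hasFDerivAt_relayS hg hP2 hα hv hq).const_mul l1)).congr_fderiv ?_
    ext <;> simp [linearForm, rateGradient] <;> ring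

theorem linearForm_gradient (m : Multipliers) (hv : v ∈ powerSimplex P1 α) :
    linearForm (m.gradient α) v =
      m.lam2 * P1 - (m.mu10 * v.1 + m.mu11 * v.2.1 + m.mu13 * v.2.2) := by
  rw [linearForm_apply, Multipliers.gradient, ← hv.2]
  ring

theorem lagrangian_eq (hg : g.Pos) (P1 P2 α : ℝ) (m : Multipliers) :
    lagrangian g P1 P2 α m = fun z => (1 - m.lam0 - m.lam1) * z.1 +
      (weightedRate g P2 α m.lam0 m.lam1 z.2 - linearForm (m.gradient α) z.2) + m.lam2 * P1 := by
  ext z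
  simp only [lagrangian, Point.J1_eq, Point.S4_eq hg, Point.powers, weightedRate,
    linearForm_apply, Multipliers.gradient]
  ring

theorem hasFDerivAt_lagrangian_zero_iff (hg : g.Pos) (P1 R : ℝ)
    (hc : HasFDerivAt (weightedRate g P2 α m.lam0 m.lam1) (linearForm c) v) :
    HasFDerivAt (lagrangian g P1 P2 α m) (0 : ℝ × ℝ × ℝ × ℝ →L[ℝ] ℝ) (R, v) ↔
      m.lam0 + m.lam1 = 1 ∧ c = m.gradient α := by
  set D : ℝ × ℝ × ℝ × ℝ →L[ℝ] ℝ := (1 - m.lam0 - m.lam1) • ContinuousLinearMap.fst ℝ ℝ _ +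
    (linearForm c - linearForm (m.gradient α)).comp (ContinuousLinearMap.snd ℝ ℝ _) with hDdef
  have hD : HasFDerivAt (lagrangian g P1 P2 α m) D (R, v) := by
    rw [lagrangian_eq hg]
    have hsnd : HasFDerivAt (fun z : ℝ × ℝ × ℝ × ℝ => z.2)
        (ContinuousLinearMap.snd ℝ ℝ (ℝ × ℝ × ℝ)) (R, v) := hasFDerivAt_snd
    exact ((hasFDerivAt_fst.const_mul _).add
      ((hc.sub (linearForm _).hasFDerivAt).comp (R, v) hsnd)).add_const _
  have hzero : D = 0 ↔ m.lam0 + m.lam1 = 1 ∧ c = m.gradient α := by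
    constructor
    · intro h
      have hR := DFunLike.congr_fun h (1, 0)
      have hw : linearForm c = linearForm (m.gradient α) := ContinuousLinearMap.ext fun w => by
        simpa [hDdef, sub_eq_zero] using DFunLike.congr_fun h (0, w)
      simp only [hDdef, add_apply, smul_apply, ContinuousLinearMap.coe_fst',
        ContinuousLinearMap.comp_apply, ContinuousLinearMap.coe_snd', map_zero, smul_eq_mul,
        mul_one, add_zero, zero_apply] at hR
      exact ⟨by linarith, linearForm_injective hw⟩
    · rintro ⟨hl, rfl⟩
      simp [hDdef, sub_sub, hl]
  exact ⟨fun h => hzero.1 (hD.unique h), fun h => hzero.2 h ▸ hD⟩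

/-! ### The KKT conditions -/

theorem a5_mul_sq (g : Gains) (P2 α q : ℝ) {t : ℝ} (ht : 0 ≤ t) :
    a5 g P2 α (q * t ^ 2) =
      a5 g P2 α 0 + 2 * (g.g20 / g.g10) * √(q * rho23 P2 α) * t + q * t ^ 2 := by
  have hsqrt : √(q * t ^ 2 * rho23 P2 α) = √(q * rho23 P2 α) * t := by
    rw [mul_right_comm, Real.sqrt_mul' _ (sq_nonneg t), Real.sqrt_sq ht]
  rw [a5, a5, hsqrt, zero_mul, Real.sqrt_zero]
  ring

theorem hasDerivAt_parabola (v w : ℝ × ℝ × ℝ) :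
    HasDerivAt (fun t : ℝ => v + t ^ 2 • (w - v)) 0 0 := by
  simpa using ((hasDerivAt_pow 2 (0 : ℝ)).smul_const (w - v)).const_add v

-- On a parabola leaving the face `ρ13 = 0` the term `√(ρ13 ρ23)` is linear in the parameter.
theorem hasDerivWithinAt_effPower_parabola (g : Gains) (P2 α : ℝ) (hv : v.2.2 = 0)
    (w : ℝ × ℝ × ℝ) :
    HasDerivWithinAt (fun t : ℝ => effPower g P2 α (v + t ^ 2 • (w - v)))
      (2 * (g.g20 / g.g10) * √(w.2.2 * rho23 P2 α)) (Set.Ici 0) 0 := by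
  set k := 2 * (g.g20 / g.g10) * √(w.2.2 * rho23 P2 α) with hk
  have hpoly : HasDerivAt (fun t : ℝ => effPower g P2 α v + k * t + (w.1 - v.1 + w.2.2) * t ^ 2)
      k 0 :=
    ((((hasDerivAt_id (0 : ℝ)).const_mul k).const_add (effPower g P2 α v)).add
      ((hasDerivAt_pow 2 (0 : ℝ)).const_mul (w.1 - v.1 + w.2.2))).congr_deriv (by simp)
  have heq : ∀ t ∈ Set.Ici (0 : ℝ), effPower g P2 α (v + t ^ 2 • (w - v)) =
      effPower g P2 α v + k * t + (w.1 - v.1 + w.2.2) * t ^ 2 := by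
    intro t ht
    simp only [effPower, Prod.fst_add, Prod.snd_add, Prod.smul_fst, Prod.smul_snd, Prod.fst_sub,
      Prod.snd_sub, smul_eq_mul, hv, sub_zero, zero_add]
    rw [mul_comm (t ^ 2) w.2.2, a5_mul_sq g P2 α w.2.2 ht, ← hk]
    ring
  exact hpoly.hasDerivWithinAt.congr_of_mem heq Set.self_mem_Ici

theorem hasDerivWithinAt_weightedRate_parabola (hg : g.Pos) (hP2 : 0 < P2) (hα : α < 1)
    (l0 l1 : ℝ) (hv : 0 ≤ v) (hq : v.2.2 = 0) (w : ℝ × ℝ × ℝ) :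
    HasDerivWithinAt (fun t : ℝ => weightedRate g P2 α l0 l1 (v + t ^ 2 • (w - v)))
      (l1 * ((1 - α) * (1 / (((g.g10 ^ 2)⁻¹ + effPower g P2 α v) * Real.log 2) *
        (2 * (g.g20 / g.g10) * √(w.2.2 * rho23 P2 α))))) (Set.Ici 0) 0 := by
  have hstart : v + (0 : ℝ) ^ 2 • (w - v) = v := by simp
  have hpath := (hasDerivAt_parabola v w).hasDerivWithinAt (s := Set.Ici 0)
  have hsnd : HasDerivWithinAt (fun t : ℝ => (v + t ^ 2 • (w - v)).2.1) 0 (Set.Ici 0) 0 :=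
    (ContinuousLinearMap.fst ℝ ℝ ℝ ∘L .snd ℝ ℝ (ℝ × ℝ)).hasFDerivAt.comp_hasDerivWithinAt_of_eq
      (0 : ℝ) hpath rfl
  have hJ := (hasFDerivAt_relayJ hg hv P2 α).comp_hasDerivWithinAt_of_eq (0 : ℝ) hpath hstart.symm
  have h10 := (hasDerivAt_cap_sq_mul hg.2.2.1 hv.2.1).comp_hasDerivWithinAt_of_eq (0 : ℝ)
    hsnd (by rw [hstart])
  have heff := (hasDerivAt_cap_sq_mul hg.2.2.1
    (effPower_pos hg hP2 hα hv).le).comp_hasDerivWithinAt_of_eq (0 : ℝ)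
    (hasDerivWithinAt_effPower_parabola g P2 α hq w) (by rw [hstart])
  refine ((hJ.const_mul l0).add (((h10.const_mul α).add
    (heff.const_mul (1 - α))).const_mul l1)).congr_deriv ?_
  simp only [map_zero, mul_zero, zero_add]

theorem thd_pos_of_isMaxOn (hg : g.Pos) (hP1 : 0 < P1) (hP2 : 0 < P2) (hα : α < 1)
    (hl1 : 0 < l1) (hv : v ∈ powerSimplex P1 α)
    (hmax : IsMaxOn (weightedRate g P2 α l0 l1) (powerSimplex P1 α) v) : 0 < v.2.2 := by
  refine hv.1.2.2.lt_of_ne' fun hq => ?_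
  have hw := vertex_thd_mem hP1.le hα
  have hmem : ∀ t ∈ Set.Icc (0 : ℝ) 1,
      v + t ^ 2 • ((0, 0, P1 / (1 - α)) - v) ∈ powerSimplex P1 α := fun t ht =>
    (convex_powerSimplex P1 α).add_smul_sub_mem hv hw ⟨sq_nonneg t, pow_le_one₀ ht.1 ht.2⟩
  have hloc : IsMaxOn (fun t : ℝ => weightedRate g P2 α l0 l1
      (v + t ^ 2 • ((0, 0, P1 / (1 - α)) - v))) (Set.Icc 0 1) 0 := fun t ht => by
    simpa using hmax (hmem t ht)
  have hnonpos := hloc.localize.hasFDerivWithinAt_nonpos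
    ((hasDerivWithinAt_weightedRate_parabola hg hP2 hα l0 l1 hv.1 hq _).mono
      Set.Icc_subset_Ici_self).hasFDerivWithinAt (y := 1)
    (mem_posTangentConeAt_of_segment_subset (by rw [zero_add, segment_eq_Icc zero_le_one]))
  have hβ := sub_pos.2 hα
  have hρ := rho23_pos hP2 hα
  have heff := effPower_pos hg hP2 hα hv.1
  have hlog := Real.log_pos one_lt_two
  obtain ⟨-, -, h10, h20⟩ := hg
  refine hnonpos.not_gt ?_
  simp only [ContinuousLinearMap.toSpanSingleton_apply, one_smul]
  positivity

theorem exists_multiplier_of_isMaxOn_linearForm (hP1 : 0 < P1) (hα0 : 0 < α) (hα : α < 1)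
    (hv : v ∈ powerSimplex P1 α) (hmax : IsMaxOn (linearForm c) (powerSimplex P1 α) v) :
    ∃ L, c.1 ≤ L * (1 - α) ∧ c.2.1 ≤ L * α ∧ c.2.2 ≤ L * (1 - α) ∧
      (L * (1 - α) - c.1) * v.1 = 0 ∧ (L * α - c.2.1) * v.2.1 = 0 ∧
      (L * (1 - α) - c.2.2) * v.2.2 = 0 := by
  have hβ := sub_pos.2 hα
  have bound {a b : ℝ} (ha : 0 < a) (h : b * (P1 / a) ≤ linearForm c v) :
      b ≤ linearForm c v / P1 * a := by
    rw [div_mul_eq_mul_div, le_div_iff₀ hP1, ← div_le_iff₀ ha, mul_div_assoc]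
    exact h
  have h1 := bound hβ (by simpa [linearForm_apply] using hmax (vertex_fst_mem hP1.le hα))
  have h2 := bound hα0 (by simpa [linearForm_apply] using hmax (vertex_snd_mem hP1.le hα0))
  have h3 := bound hβ (by simpa [linearForm_apply] using hmax (vertex_thd_mem hP1.le hα))
  have hL : linearForm c v / P1 * (α * v.2.1 + (1 - α) * (v.1 + v.2.2)) = linearForm c v := by
    rw [hv.2, div_mul_cancel₀ _ hP1.ne']
  refine ⟨linearForm c v / P1, h1, h2, h3, ?_⟩
  generalize linearForm c v / P1 = L at h1 h2 h3 hL ⊢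
  rw [linearForm_apply] at hL
  have e1 := mul_nonneg (sub_nonneg.2 h1) hv.1.1
  have e2 := mul_nonneg (sub_nonneg.2 h2) hv.1.2.1
  have e3 := mul_nonneg (sub_nonneg.2 h3) hv.1.2.2
  refine ⟨?_, ?_, ?_⟩ <;> linarith

theorem IsOptimal.exists_isMaxOn_weightedRate (hg : g.Pos) (hP2 : 0 < P2) (hα0 : 0 < α)
    (hα : α < 1) (hx : IsOptimal g P1 P2 α x) :
    ∃ l0 l1 : ℝ, 0 ≤ l0 ∧ 0 ≤ l1 ∧ l0 + l1 = 1 ∧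
      IsMaxOn (weightedRate g P2 α l0 l1) (powerSimplex P1 α) x.powers ∧
      l0 * (x.R - relayJ g α x.powers) = 0 ∧ l1 * (x.R - relayS g P2 α x.powers) = 0 := by
  obtain ⟨hv, hmax, hR⟩ := (isOptimal_iff hg).1 hx
  obtain ⟨-, hRJ, hRS⟩ := (Point.feasible_iff hg).1 hx.1
  have hsub : powerSimplex P1 α ⊆ Set.Ici 0 := fun _ h => h.1
  obtain ⟨l0, l1, h0, h1, hl, hle⟩ := exists_convexCombination_le
    (isCompact_powerSimplex P1 hα0 hα) ⟨_, hv⟩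
    ((concaveOn_relayJ hg hα0.le hα.le).subset hsub (convex_powerSimplex P1 α))
    ((concaveOn_relayS hg hP2 hα0.le hα).subset hsub (convex_powerSimplex P1 α))
    ((continuousOn_relayJ g α).mono hsub) ((continuousOn_relayS hg hP2 hα).mono hsub)
    (fun w hw => (hmax hw).trans_eq hR.symm)
  have hJ := mul_le_mul_of_nonneg_left hRJ h0
  have hS := mul_le_mul_of_nonneg_left hRS h1
  have hsum : l0 * x.R + l1 * x.R = x.R := by rw [← add_mul, hl, one_mul]
  have hxle := hle _ hv
  refine ⟨l0, l1, h0, h1, hl, fun w hw => (hle w hw).trans ?_, ?_, ?_⟩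
  · rw [weightedRate]
    linarith
  · linarith
  · linarith

theorem IsOptimal.exists_isKKT (hg : g.Pos) (hP1 : 0 < P1) (hP2 : 0 < P2) (hα0 : 0 < α)
    (hα : α < 1) (hx : IsOptimal g P1 P2 α x) : ∃ m : Multipliers, IsKKT g P1 P2 α x m := by
  obtain ⟨l0, l1, h0, h1, hl, hmax, hJ, hS⟩ := hx.exists_isMaxOn_weightedRate hg hP2 hα0 hα
  have hv := ((isOptimal_iff hg).1 hx).1
  have hq : l1 = 0 ∨ 0 < x.powers.2.2 := h1.eq_or_lt.imp Eq.symm fun h =>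
    thd_pos_of_isMaxOn hg hP1 hP2 hα h hv hmax
  have hD := hasFDerivAt_weightedRate (l0 := l0) hg hP2 hα hv.1 hq
  obtain ⟨L, k1, k2, k3, s1, s2, s3⟩ := exists_multiplier_of_isMaxOn_linearForm hP1 hα0 hα hv
    (isMaxOn_hasFDerivAt (convex_powerSimplex P1 α) hv hmax hD)
  set c := rateGradient g P2 α l0 l1 x.powers with hc
  have hc0 : 0 ≤ c.1 := by
    have := sub_pos.2 hα
    have := Real.log_pos one_lt_two
    have := a2_pos hg hv.1.1
    have := a2_pos hg (effPower_pos hg hP2 hα hv.1).le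
    simp only [hc, rateGradient]
    positivity
  refine ⟨⟨l0, l1, L, L * (1 - α) - c.1, L * α - c.2.1, L * (1 - α) - c.2.2⟩, ?_, hx.1, h0, h1,
    nonneg_of_mul_nonneg_left (hc0.trans k1) (sub_pos.2 hα), sub_nonneg.2 k1, sub_nonneg.2 k2,
    sub_nonneg.2 k3, s1, s2, s3, by rwa [Point.J1_eq], by rwa [Point.S4_eq hg]⟩
  refine (hasFDerivAt_lagrangian_zero_iff hg P1 x.R hD).2 ⟨hl, ?_⟩
  simp [Multipliers.gradient]

theorem IsKKT.powers_mem (hg : g.Pos) (h : IsKKT g P1 P2 α x m) :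
    x.powers ∈ powerSimplex P1 α :=
  ((Point.feasible_iff hg).1 h.2.1).1

theorem IsKKT.rate_eq_J1 (h : IsKKT g P1 P2 α x m) (hm : 0 < m.lam0) : x.R = x.J1 g P2 α := by
  obtain ⟨-, -, -, -, -, -, -, -, -, -, -, hJ, -⟩ := h
  exact sub_eq_zero.1 ((mul_eq_zero.1 hJ).resolve_left hm.ne')

theorem IsKKT.rate_eq_S4 (h : IsKKT g P1 P2 α x m) (hm : 0 < m.lam1) : x.R = x.S4 g P2 α := by
  obtain ⟨-, -, -, -, -, -, -, -, -, -, -, -, hS⟩ := h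
  exact sub_eq_zero.1 ((mul_eq_zero.1 hS).resolve_left hm.ne')

-- The Lagrangian is concave, so its critical point is a global maximum.
theorem IsKKT.isMaxOn_weightedRate (hg : g.Pos) (hP2 : 0 < P2) (hα0 : 0 < α) (hα : α < 1)
    (h : IsKKT g P1 P2 α x m) :
    IsMaxOn (weightedRate g P2 α m.lam0 m.lam1) (powerSimplex P1 α) x.powers := by
  obtain ⟨hd, hf, h0, h1, -, k10, k11, k13, c10, c11, c13, -, -⟩ := h
  have hv := ((Point.feasible_iff hg).1 hf).1
  have hconc : ConcaveOn ℝ (Prod.snd ⁻¹' Set.Ici 0) (lagrangian g P1 P2 α m) := by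
    rw [lagrangian_eq hg]
    refine ConcaveOn.add_const (.add ?_ ?_) _
    · exact ((1 - m.lam0 - m.lam1) • LinearMap.fst ℝ ℝ (ℝ × ℝ × ℝ)).concaveOn
        ((convex_Ici 0).linear_preimage (LinearMap.snd ℝ ℝ (ℝ × ℝ × ℝ)))
    · exact ((concaveOn_weightedRate hg hP2 hα0.le hα h0 h1).sub
        ((linearForm (m.gradient α)).toLinearMap.convexOn (convex_Ici 0))).comp_linearMap
        (LinearMap.snd ℝ ℝ (ℝ × ℝ × ℝ))
  have hmax := isMaxOn_of_concaveOn_of_hasFDerivAt_zero (x := (x.R, x.powers)) hconc hv.1 hd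
  intro w hw
  have hle : lagrangian g P1 P2 α m (x.R, w) ≤ lagrangian g P1 P2 α m (x.R, x.powers) :=
    hmax (a := (x.R, w)) hw.1
  simp only [lagrangian_eq hg, linearForm_gradient m hv, linearForm_gradient m hw] at hle
  have e10 := mul_nonneg k10 hw.1.1
  have e11 := mul_nonneg k11 hw.1.2.1
  have e13 := mul_nonneg k13 hw.1.2.2
  simp only [Point.powers] at hle ⊢
  change weightedRate g P2 α m.lam0 m.lam1 w ≤ _
  linarith

theorem IsKKT.thd_pos (hg : g.Pos) (hP1 : 0 < P1) (hP2 : 0 < P2) (hα0 : 0 < α) (hα : α < 1)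
    (h : IsKKT g P1 P2 α x m) (hm : 0 < m.lam1) : 0 < x.ρ13 :=
  thd_pos_of_isMaxOn hg hP1 hP2 hα hm (h.powers_mem hg) (h.isMaxOn_weightedRate hg hP2 hα0 hα)

theorem IsKKT.stationary (hg : g.Pos) (hP1 : 0 < P1) (hP2 : 0 < P2) (hα0 : 0 < α) (hα : α < 1)
    (h : IsKKT g P1 P2 α x m) :
    m.lam0 + m.lam1 = 1 ∧ rateGradient g P2 α m.lam0 m.lam1 x.powers = m.gradient α := by
  have hq : m.lam1 = 0 ∨ 0 < x.powers.2.2 := h.2.2.2.1.eq_or_lt.imp Eq.symm fun hm =>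
    h.thd_pos hg hP1 hP2 hα0 hα hm
  exact (hasFDerivAt_lagrangian_zero_iff hg P1 x.R
    (hasFDerivAt_weightedRate hg hP2 hα (h.powers_mem hg).1 hq)).1 h.1

theorem IsKKT.stationary_powers (hg : g.Pos) (hP1 : 0 < P1) (hP2 : 0 < P2) (hα0 : 0 < α)
    (hα : α < 1) (h : IsKKT g P1 P2 α x m) :
    m.lam0 / a2 g x.ρ10 + m.lam1 / a2 g (effPower g P2 α x.powers)
      + m.mu10 * (Real.log 2 / (1 - α)) = m.lam2 * Real.log 2 ∧
    m.lam0 / a3 g x.ρ11 + m.lam1 / a2 g x.ρ11 + m.mu11 * (Real.log 2 / α)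
      = m.lam2 * Real.log 2 ∧
    m.lam1 / a2 g (effPower g P2 α x.powers) * a4 g P2 α x.ρ13
      + m.mu13 * (Real.log 2 / (1 - α)) = m.lam2 * Real.log 2 := by
  have hlog := Real.log_pos one_lt_two
  have rescale {a u μ : ℝ} (ha : 0 < a) (hu : a / Real.log 2 * u = m.lam2 * a - μ) :
      u + μ * (Real.log 2 / a) = m.lam2 * Real.log 2 := by
    field_simp at hu ⊢
    linear_combination hu
  have hgrad := (h.stationary hg hP1 hP2 hα0 hα).2
  simp only [rateGradient, Multipliers.gradient, Prod.mk.injEq, Point.powers] at hgrad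
  have hβ := sub_pos.2 hα
  exact ⟨rescale hβ hgrad.1, rescale hα0 hgrad.2.1, rescale hβ hgrad.2.2⟩

theorem IsKKT.isOptimal (hg : g.Pos) (hP1 : 0 < P1) (hP2 : 0 < P2) (hα0 : 0 < α) (hα : α < 1)
    (h : IsKKT g P1 P2 α x m) : IsOptimal g P1 P2 α x := by
  refine ⟨h.2.1, fun y hy => ?_⟩
  obtain ⟨hyv, hyJ, hyS⟩ := (Point.feasible_iff hg).1 hy
  have hl := (h.stationary hg hP1 hP2 hα0 hα).1
  have hmax : weightedRate g P2 α m.lam0 m.lam1 y.powers ≤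
      weightedRate g P2 α m.lam0 m.lam1 x.powers := h.isMaxOn_weightedRate hg hP2 hα0 hα hyv
  obtain ⟨-, -, h0, h1, -, -, -, -, -, -, -, hJ, hS⟩ := h
  rw [Point.J1_eq] at hJ
  rw [Point.S4_eq hg] at hS
  calc y.R = m.lam0 * y.R + m.lam1 * y.R := by rw [← add_mul, hl, one_mul]
    _ ≤ weightedRate g P2 α m.lam0 m.lam1 y.powers := by rw [weightedRate]; gcongr
    _ ≤ weightedRate g P2 α m.lam0 m.lam1 x.powers := hmax
    _ = m.lam0 * x.R + m.lam1 * x.R := by rw [weightedRate]; linear_combination -hJ - hS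
    _ = x.R := by rw [← add_mul, hl, one_mul]

/-! ### Schemes used by relay designs -/

theorem mul_cap_fst_le_mul_cap_effPower (hg : g.Pos) (hP2 : 0 < P2) (hα : α < 1) (hv : 0 ≤ v) :
    (1 - α) * cap (g.g10 ^ 2 * v.1) ≤ (1 - α) * cap (g.g10 ^ 2 * effPower g P2 α v) :=
  mul_le_mul_of_nonneg_left ((strictMonoOn_cap_sq_mul hg.2.2.1).monotoneOn hv.1
    (effPower_pos hg hP2 hα hv).le (lt_effPower hg hP2 hα hv).le) (sub_nonneg.2 hα.le)

variable {R : ℝ} {s : RateSplit}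

theorem delivers_relayDesign_iff (hg : g.Pos) (hP2 : 0 < P2) (hα : α < 1) (hx : 0 ≤ x.powers) :
    Delivers g (relayDesign P2 α x) R s ↔ 0 ≤ s.R10 ∧ 0 ≤ s.R12 ∧ s.R20 = 0 ∧ s.R21 = 0 ∧
      s.R10 + s.R12 = R ∧ s.R12 ≤ α * cap (g.g12 ^ 2 * x.ρ11) ∧
      s.R10 ≤ (1 - α) * cap (g.g10 ^ 2 * x.ρ10) ∧ R ≤ relayS g P2 α x.powers := by
  have hle := mul_cap_fst_le_mul_cap_effPower hg hP2 hα hx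
  simp only [Delivers, Decodable, Design.I1, Design.I2, Design.I3, Design.I4, Design.I5,
    Design.I6, Design.I7, Design.I8, zeta_relayDesign hg, Design.α3]
  simp only [relayDesign, mul_zero, cap_zero, add_zero, zero_add, sub_zero, relayS, Point.powers]
    at hle ⊢
  constructor
  · rintro ⟨⟨h10, h12, -, -, hI1, -, hI3, -, -, -, -, hI8⟩, rfl, h20, h21⟩
    simp only [h20, h21, add_zero] at hI8
    exact ⟨h10, h12, h20, h21, rfl, hI1, hI3, hI8⟩
  · rintro ⟨h10, h12, h20, h21, rfl, hI1, hI3, hI8⟩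
    simp only [h20, h21, add_zero]
    exact ⟨⟨h10, h12, le_rfl, le_rfl, hI1, le_rfl, hI3, le_rfl, hI3, hI8, hI3.trans hle, hI8⟩,
      trivial, trivial, trivial⟩

theorem Point.Feasible.exists_delivers (hg : g.Pos) (hP2 : 0 < P2) (hα0 : 0 < α) (hα : α < 1)
    (hx : x.Feasible g P1 P2 α) (hR : 0 ≤ x.R) :
    ∃ s, Delivers g (relayDesign P2 α x) x.R s := by
  obtain ⟨hv, hJ, hS⟩ := (Point.feasible_iff hg).1 hx
  have h12 : 0 ≤ α * cap (g.g12 ^ 2 * x.ρ11) :=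
    mul_nonneg hα0.le (cap_nonneg (mul_nonneg (sq_nonneg _) hv.1.2.1))
  have h10 : 0 ≤ (1 - α) * cap (g.g10 ^ 2 * x.ρ10) :=
    mul_nonneg (sub_nonneg.2 hα.le) (cap_nonneg (mul_nonneg (sq_nonneg _) hv.1.1))
  set I := (1 - α) * cap (g.g10 ^ 2 * x.ρ10)
  refine ⟨⟨min x.R I, x.R - min x.R I, 0, 0⟩, (delivers_relayDesign_iff hg hP2 hα hv.1).2
    ⟨le_min hR h10, sub_nonneg.2 (min_le_left _ _), rfl, rfl, add_sub_cancel _ _, ?_,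
      min_le_right _ _, hS⟩⟩
  rw [sub_le_comm]
  exact le_min (sub_le_self _ h12) (sub_le_iff_le_add'.2 hJ)

theorem Delivers.parts_pos (hg : g.Pos) (hP2 : 0 < P2) (hα0 : 0 < α) (hα : α < 1)
    (hx : 0 ≤ x.powers) (hJ : R = relayJ g α x.powers) (hp : 0 < x.ρ10) (hr : 0 < x.ρ11)
    (h : Delivers g (relayDesign P2 α x) R s) : 0 < s.R10 ∧ 0 < s.R12 := by
  obtain ⟨-, -, -, -, hsum, hI1, hI3, -⟩ := (delivers_relayDesign_iff hg hP2 hα hx).1 h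
  have h12 : 0 < α * cap (g.g12 ^ 2 * x.ρ11) := mul_pos hα0 (cap_pos (mul_pos (pow_pos hg.1 2) hr))
  have h10 : 0 < (1 - α) * cap (g.g10 ^ 2 * x.ρ10) :=
    mul_pos (sub_pos.2 hα) (cap_pos (mul_pos (pow_pos hg.2.2.1 2) hp))
  simp only [relayJ, Point.powers] at hJ
  constructor <;> linarith

theorem Delivers.parts_of_fst_eq_zero (hg : g.Pos) (hP2 : 0 < P2) (hα : α < 1)
    (hx : 0 ≤ x.powers) (hR : 0 < R) (hp : x.ρ10 = 0)
    (h : Delivers g (relayDesign P2 α x) R s) : s.R10 = 0 ∧ 0 < s.R12 := by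
  obtain ⟨h10, -, -, -, hsum, -, hI3, -⟩ := (delivers_relayDesign_iff hg hP2 hα hx).1 h
  rw [hp, mul_zero, cap_zero, mul_zero] at hI3
  constructor <;> linarith

theorem sent11_relayDesign (hα0 : 0 < α) (hr : 0 < x.ρ11) (h12 : 0 < s.R12) :
    sent11 (relayDesign P2 α x) s = {.w12} := by
  ext m
  simp only [sent11, relayDesign, Set.mem_ofPred_eq, Set.mem_singleton_iff]
  refine ⟨fun h => h.2.2.1, ?_⟩
  rintro rfl
  exact ⟨h12, hα0, rfl, hr⟩

theorem sent23_relayDesign (hP2 : 0 < P2) (hα : α < 1) (h12 : 0 < s.R12) (h21 : s.R21 = 0) :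
    sent23 (relayDesign P2 α x) s = {.w12} := by
  have hρ := rho23_pos hP2 hα
  ext m
  cases m <;> simp [sent23, relayDesign, Design.α3, RateSplit.rate, h12, h21, hρ, hα]

theorem mem_sent13_relayDesign (hα : α < 1) (h21 : s.R21 = 0) (m : MessagePart) :
    m ∈ sent13 (relayDesign P2 α x) s ↔
      (m = .w10 ∧ 0 < s.R10 ∧ 0 < x.ρ10) ∨ (m = .w12 ∧ 0 < s.R12 ∧ 0 < x.ρ13) := by
  cases m <;> simp [sent13, relayDesign, Design.α3, RateSplit.rate, h21, hα]

theorem Point.Feasible.usesScheme_pdfRepetition (hg : g.Pos) (hP2 : 0 < P2) (hα0 : 0 < α)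
    (hα : α < 1) (hx : x.Feasible g P1 P2 α) (hR : 0 < x.R) (hJ : x.R = x.J1 g P2 α)
    (hp : 0 < x.ρ10) (hr : 0 < x.ρ11) (hq : 0 < x.ρ13) :
    UsesScheme g (relayDesign P2 α x) x.R IsPDFRepetition := by
  refine ⟨hx.exists_delivers hg hP2 hα0 hα hR.le, fun s hs => ?_⟩
  have hv := ((Point.feasible_iff hg).1 hx).1.1
  obtain ⟨h10, h12⟩ := hs.parts_pos hg hP2 hα0 hα hv (hJ.trans (x.J1_eq g P2 α)) hp hr
  refine ⟨rfl, sent11_relayDesign hα0 hr h12, ?_, sent23_relayDesign hP2 hα h12 hs.2.2.2⟩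
  ext m
  simp [mem_sent13_relayDesign hα hs.2.2.2, h10, h12, hp, hq]

theorem Point.Feasible.usesScheme_pdfNoRepetition (hg : g.Pos) (hP2 : 0 < P2) (hα0 : 0 < α)
    (hα : α < 1) (hx : x.Feasible g P1 P2 α) (hR : 0 < x.R) (hJ : x.R = x.J1 g P2 α)
    (hp : 0 < x.ρ10) (hr : 0 < x.ρ11) (hq : x.ρ13 = 0) :
    UsesScheme g (relayDesign P2 α x) x.R IsPDFNoRepetition := by
  refine ⟨hx.exists_delivers hg hP2 hα0 hα hR.le, fun s hs => ?_⟩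
  have hv := ((Point.feasible_iff hg).1 hx).1.1
  obtain ⟨h10, h12⟩ := hs.parts_pos hg hP2 hα0 hα hv (hJ.trans (x.J1_eq g P2 α)) hp hr
  refine ⟨rfl, sent11_relayDesign hα0 hr h12, ?_, sent23_relayDesign hP2 hα h12 hs.2.2.2⟩
  ext m
  simp [mem_sent13_relayDesign hα hs.2.2.2, h10, hp, hq]

theorem Point.Feasible.usesScheme_df (hg : g.Pos) (hP2 : 0 < P2) (hα0 : 0 < α) (hα : α < 1)
    (hx : x.Feasible g P1 P2 α) (hR : 0 < x.R) (hp : x.ρ10 = 0) (hr : 0 < x.ρ11)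
    (hq : 0 < x.ρ13) : UsesScheme g (relayDesign P2 α x) x.R IsDF := by
  refine ⟨hx.exists_delivers hg hP2 hα0 hα hR.le, fun s hs => ?_⟩
  have hv := ((Point.feasible_iff hg).1 hx).1.1
  obtain ⟨h10, h12⟩ := hs.parts_of_fst_eq_zero hg hP2 hα hv hR hp
  refine ⟨rfl, h10, sent11_relayDesign hα0 hr h12, ?_, sent23_relayDesign hP2 hα h12 hs.2.2.2⟩
  ext m
  simp [mem_sent13_relayDesign hα hs.2.2.2, h10, h12, hq]

theorem Point.Feasible.usesScheme_twoHop (hg : g.Pos) (hP2 : 0 < P2) (hα0 : 0 < α) (hα : α < 1)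
    (hx : x.Feasible g P1 P2 α) (hR : 0 < x.R) (hp : x.ρ10 = 0) (hr : 0 < x.ρ11)
    (hq : x.ρ13 = 0) : UsesScheme g (relayDesign P2 α x) x.R IsTwoHop := by
  refine ⟨hx.exists_delivers hg hP2 hα0 hα hR.le, fun s hs => ?_⟩
  have hv := ((Point.feasible_iff hg).1 hx).1.1
  obtain ⟨h10, h12⟩ := hs.parts_of_fst_eq_zero hg hP2 hα hv hR hp
  exact ⟨rfl, h10, sent11_relayDesign hα0 hr h12, hp, hq,
    sent23_relayDesign hP2 hα h12 hs.2.2.2⟩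

/-! ### The four kinds of KKT points -/

theorem relayJ_lt_relayS (hg : g.Pos) (hP2 : 0 < P2) (hα : α < 1) (hv : 0 ≤ v)
    (hr : v.2.1 = 0) : relayJ g α v < relayS g P2 α v := by
  simp only [relayJ, relayS, hr, mul_zero]
  exact add_lt_add_right (mul_lt_mul_of_pos_left (strictMonoOn_cap_sq_mul hg.2.2.1 hv.1
    (effPower_pos hg hP2 hα hv).le (lt_effPower hg hP2 hα hv)) (sub_pos.2 hα)) _

theorem IsOptimal.rate_pos (hg : g.Pos) (hP1 : 0 < P1) (hP2 : 0 < P2) (hα0 : 0 < α)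
    (hα : α < 1) (h : IsOptimal g P1 P2 α x) : 0 < x.R := by
  obtain ⟨-, hmax, hR⟩ := (isOptimal_iff hg).1 h
  have hβ := sub_pos.2 hα
  have hmem := vertex_snd_mem hP1.le hα0
  rw [hR]
  refine lt_of_lt_of_le (lt_min ?_ ?_) (hmax hmem)
  · simp only [relayJ, mul_zero, cap_zero, add_zero]
    exact mul_pos hα0 (cap_pos (mul_pos (pow_pos hg.1 2) (div_pos hP1 hα0)))
  · exact add_pos_of_nonneg_of_pos
      (mul_nonneg hα0.le (cap_nonneg (mul_nonneg (sq_nonneg _) hmem.1.2.1)))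
      (mul_pos hβ (cap_pos (mul_pos (pow_pos hg.2.2.1 2) (effPower_pos hg hP2 hα hmem.1))))

theorem IsKKT.snd_pos (hg : g.Pos) (hP2 : 0 < P2) (hα : α < 1) (h : IsKKT g P1 P2 α x m)
    (hm : 0 < m.lam1) : 0 < x.ρ11 := by
  obtain ⟨hv, hJ, -⟩ := (Point.feasible_iff hg).1 h.2.1
  refine hv.1.2.1.lt_of_ne' fun hr => ?_
  have hS := h.rate_eq_S4 hm
  rw [Point.S4_eq hg] at hS
  exact hJ.not_gt (hS ▸ relayJ_lt_relayS hg hP2 hα hv.1 hr)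

theorem IsKKT.mu11_eq_zero (h : IsKKT g P1 P2 α x m) (hr : 0 < x.ρ11) : m.mu11 = 0 := by
  obtain ⟨-, -, -, -, -, -, -, -, -, c11, -⟩ := h
  exact (mul_eq_zero.1 c11).resolve_right hr.ne'

theorem IsKKT.mu13_eq_zero (h : IsKKT g P1 P2 α x m) (hq : 0 < x.ρ13) : m.mu13 = 0 := by
  obtain ⟨-, -, -, -, -, -, -, -, -, -, c13, -⟩ := h
  exact (mul_eq_zero.1 c13).resolve_right hq.ne'

theorem IsKKT.fst_eq_zero (h : IsKKT g P1 P2 α x m) (hm : 0 < m.mu10) : x.ρ10 = 0 := by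
  obtain ⟨-, -, -, -, -, -, -, -, c10, -⟩ := h
  exact (mul_eq_zero.1 c10).resolve_left hm.ne'

theorem IsKKT.cases (h : IsKKT g P1 P2 α x m) :
    Case2a m ∨ Case2b m ∨ Case3a m ∨ Case3b m := by
  obtain ⟨-, -, -, h1, -, h10, -⟩ := h
  rcases h1.eq_or_lt with h1 | h1 <;> rcases h10.eq_or_lt with h10 | h10
  · exact .inr (.inr (.inl ⟨h1.symm, h10.symm⟩))
  · exact .inr (.inr (.inr ⟨h1.symm, h10⟩))
  · exact .inl ⟨h1, h10.symm⟩
  · exact .inr (.inl ⟨h1, h10⟩)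

theorem a4_sub_one_pos (hg : g.Pos) (hP2 : 0 < P2) (hα : α < 1) (hq : 0 < q) :
    0 < a4 g P2 α q - 1 := by
  have hρ := rho23_pos hP2 hα
  obtain ⟨-, -, h10, h20⟩ := hg
  rw [a4, add_sub_cancel_left]
  positivity

/-- The relation between the three powers that is left when the multipliers are eliminated from the
stationarity conditions with `mu10 = mu11 = mu13 = 0`. -/
def IsBalanced (g : Gains) (P2 α : ℝ) (v : ℝ × ℝ × ℝ) : Prop :=
  (a4 g P2 α v.2.2 - 1) * a2 g v.1 * a2 g v.2.1 + a2 g (effPower g P2 α v) * a3 g v.2.1 =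
    a4 g P2 α v.2.2 * a2 g v.2.1 * a3 g v.2.1

theorem IsKKT.isBalanced (hg : g.Pos) (hP1 : 0 < P1) (hP2 : 0 < P2) (hα0 : 0 < α)
    (hα : α < 1) (h : IsKKT g P1 P2 α x m) (hc : Case2a m) :
    0 < m.lam0 ∧ IsBalanced g P2 α x.powers := by
  obtain ⟨hm, hmu10⟩ := hc
  have hq := h.thd_pos hg hP1 hP2 hα0 hα hm
  have hv := (h.powers_mem hg).1
  obtain ⟨E10, E11, E13⟩ := h.stationary_powers hg hP1 hP2 hα0 hα
  rw [hmu10, zero_mul, add_zero] at E10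
  rw [h.mu11_eq_zero (h.snd_pos hg hP2 hα hm), zero_mul, add_zero] at E11
  rw [h.mu13_eq_zero hq, zero_mul, add_zero] at E13
  have hT := a4_sub_one_pos hg hP2 hα hq
  have hA10 : 0 < a2 g x.ρ10 := a2_pos hg hv.1
  have hA11 : 0 < a2 g x.ρ11 := a2_pos hg hv.2.1
  have hB : 0 < a3 g x.ρ11 := a3_pos hg hv.2.1
  have hD := a2_pos hg (effPower_pos hg hP2 hα hv).le
  rw [IsBalanced]
  generalize a2 g (effPower g P2 α x.powers) = D at E10 E13 hD ⊢
  have hlam0 : m.lam0 = m.lam1 / D * (a4 g P2 α x.ρ13 - 1) * a2 g x.ρ10 := by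
    rw [← div_eq_iff hA10.ne']
    linear_combination E10 - E13
  refine ⟨hlam0 ▸ by positivity, ?_⟩
  have e := E11.trans E13.symm
  rw [hlam0] at e
  simp only [Point.powers]
  field_simp at e
  linear_combination e

theorem eq_larger_root {t b c y : ℝ} (ht : 0 < t) (hy : 0 < y) (h : t * y ^ 2 - b * y + c = 0)
    (hc : c ≤ t * y ^ 2) : y = (2 * t)⁻¹ * (b + √(b ^ 2 - 4 * t * c)) := by
  have hlarge : 0 ≤ 2 * t * y - b := by
    refine nonneg_of_mul_nonneg_left (b := y) ?_ hy
    linear_combination hc - h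
  have hsq : b ^ 2 - 4 * t * c = (2 * t * y - b) ^ 2 := by linear_combination -4 * t * h
  rw [hsq, Real.sqrt_sq hlarge]
  field_simp
  ring

theorem b2_eq_mul (g : Gains) (P2 α : ℝ) (v : ℝ × ℝ × ℝ)
    (hv : α * v.2.1 + (1 - α) * (v.1 + v.2.2) = P1) :
    b2 g P1 P2 α v.2.2 =
      a1 g * ((1 - α) * a2 g (effPower g P2 α v) + α * a2 g v.2.1) := by
  rw [b2, ← hv, effPower, a5, a2, a2]
  ring

-- With the power equality, the balance relation becomes a quadratic equation for `a2 g ρ11`; the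
-- upper bound on `b2`, the product of its roots times `a4`, singles out the larger root.
theorem snd_eq_rho11Of (hg : g.Pos) (hP2 : 0 < P2) (hα0 : 0 ≤ α) (hα : α < 1)
    (hv : v ∈ powerSimplex P1 α) (hq : 0 < v.2.2)
    (h : IsBalanced g P2 α v) :
    v.2.1 = rho11Of g P1 P2 α v.2.2 := by
  have hβ := sub_nonneg.2 hα.le
  have hT := a4_sub_one_pos hg hP2 hα hq
  have hA10 := a2_pos hg hv.1.1
  have hA11 := a2_pos hg hv.1.2.1
  have hB := a3_pos hg hv.1.2.1
  have hD := a2_pos hg (effPower_pos hg hP2 hα hv.1).le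
  rw [IsBalanced] at h
  have hBA : a3 g v.2.1 = a2 g v.2.1 - a1 g := by rw [a1, a2, a3]; ring
  have hρ11 : v.2.1 = a2 g v.2.1 - (g.g10 ^ 2)⁻¹ := (add_sub_cancel_left _ _).symm
  rw [rho11Of, ← eq_larger_root (y := a2 g v.2.1) (by linarith) hA11 ?_ ?_]
  · exact hρ11
  · rw [b2_eq_mul g P2 α v hv.2, b1, ← hv.2]
    rw [hBA] at h
    simp only [effPower, a2] at h ⊢
    linear_combination (-(1 - α)) * h
  · have hDle : a2 g (effPower g P2 α v) ≤ a4 g P2 α v.2.2 * a2 g v.2.1 := by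
      have := mul_pos (mul_pos hT hA10) hA11
      exact le_of_mul_le_mul_right (by linarith) hB
    have hAle : a2 g v.2.1 ≤ a4 g P2 α v.2.2 * a2 g v.2.1 :=
      le_mul_of_one_le_left hA11.le (by linarith)
    rw [b2_eq_mul g P2 α v hv.2]
    calc a1 g * ((1 - α) * a2 g (effPower g P2 α v) + α * a2 g v.2.1)
        ≤ a2 g v.2.1 * ((1 - α) * (a4 g P2 α v.2.2 * a2 g v.2.1)
            + α * (a4 g P2 α v.2.2 * a2 g v.2.1)) := by
          gcongr
          linarith
      _ = a4 g P2 α v.2.2 * a2 g v.2.1 ^ 2 := by ring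

theorem fst_eq_rho10Of (hg : g.Pos) (hP2 : 0 < P2) (hα : α < 1) (hv : 0 ≤ v) (hq : 0 < v.2.2)
    (h : IsBalanced g P2 α v) :
    v.1 = rho10Of g P2 α v.2.1 v.2.2 := by
  have hT := a4_sub_one_pos hg hP2 hα hq
  have hA11 := a2_pos hg hv.2.1
  have hB := a3_pos hg hv.2.1
  rw [IsBalanced] at h
  have ha4 : g.g20 / g.g10 * √(rho23 P2 α / v.2.2) = a4 g P2 α v.2.2 - 1 := by
    rw [a4, add_sub_cancel_left]
  rw [rho10Of, ha4, eq_sub_iff_add_eq, eq_inv_mul_iff_mul_eq₀ (by positivity)]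
  generalize a2 g v.2.1 = A at h hA11 ⊢
  simp only [effPower, a2] at h
  field_simp
  linear_combination h

theorem f2_eq_zero (hg : g.Pos) (hα : α < 1) (hv : v ∈ powerSimplex P1 α)
    (hr : v.2.1 = rho11Of g P1 P2 α v.2.2) (hp : v.1 = rho10Of g P2 α v.2.1 v.2.2)
    (hJS : relayJ g α v = relayS g P2 α v) : f2 g P1 P2 α v.2.2 = 0 := by
  have hβ := sub_pos.2 hα
  have hf1 : f1 g P2 α v.1 v.2.1 v.2.2 / (1 - α) = cap (g.g10 ^ 2 * v.1) := by
    rw [div_eq_iff hβ.ne', f1]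
    simp only [relayJ, relayS, effPower] at hJS
    linear_combination -hJS
  have := hg.2.2.1
  simp only [f2]
  rw [← hr, ← hp, hf1, two_rpow_cap (mul_nonneg (sq_nonneg _) hv.1.1), ← hv.2]
  field_simp
  ring

theorem IsKKT.case2a (hg : g.Pos) (hP1 : 0 < P1) (hP2 : 0 < P2) (hα0 : 0 < α) (hα : α < 1)
    (h : IsKKT g P1 P2 α x m) (hc : Case2a m) : Case2aConclusion g P1 P2 α x m := by
  obtain ⟨hlam0, hkey⟩ := h.isBalanced hg hP1 hP2 hα0 hα hc
  have hv := h.powers_mem hg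
  have hq := h.thd_pos hg hP1 hP2 hα0 hα hc.1
  have hr := h.snd_pos hg hP2 hα hc.1
  have hRpos := (h.isOptimal hg hP1 hP2 hα0 hα).rate_pos hg hP1 hP2 hα0 hα
  have hJ := h.rate_eq_J1 hlam0
  have hS := h.rate_eq_S4 hc.1
  have hJS : relayJ g α x.powers = relayS g P2 α x.powers := by
    rw [← Point.J1_eq g P2, ← Point.S4_eq hg, ← hJ, hS]
  have hρ11 : x.ρ11 = rho11Of g P1 P2 α x.ρ13 :=
    snd_eq_rho11Of (v := x.powers) hg hP2 hα0.le hα hv hq hkey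
  have hρ10 : x.ρ10 = rho10Of g P2 α x.ρ11 x.ρ13 :=
    fst_eq_rho10Of (v := x.powers) hg hP2 hα hv.1 hq hkey
  have hf2 : f2 g P1 P2 α x.ρ13 = 0 := f2_eq_zero (v := x.powers) hg hα hv hρ11 hρ10 hJS
  exact ⟨hlam0, hJ, hS, hq, hf2, hρ11, hρ10,
    fun hp => h.2.1.usesScheme_pdfRepetition hg hP2 hα0 hα hRpos hJ hp hr hq,
    fun hp => h.2.1.usesScheme_df hg hP2 hα0 hα hRpos hp hr hq⟩

theorem f4_eq_zero (hg : g.Pos) (hP2 : 0 < P2) (hα0 : 0 < α) (hα : α < 1)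
    (hv : v ∈ powerSimplex P1 α) (hp : v.1 = 0) (hJS : relayJ g α v = relayS g P2 α v) :
    f4 g P1 P2 α v.2.2 = 0 := by
  have hr : 0 ≤ v.2.1 := hv.1.2.1
  have hα' := sub_pos.2 hα
  have h10 := hg.2.2.1
  have hcap : 0 < cap (g.g10 ^ 2 * a5 g P2 α v.2.2) :=
    cap_pos (mul_pos (pow_pos h10 2) (a5_pos hg hP2 hα hv.1.2.2))
  simp only [relayJ, relayS, effPower, hp, mul_zero, cap_zero, add_zero, zero_add] at hJS
  have hf3 : f3 g P2 α v.2.2 = cap (g.g12 ^ 2 * v.2.1) - cap (g.g10 ^ 2 * v.2.1) := by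
    rw [f3, div_mul_eq_mul_div, div_eq_iff hα0.ne']
    linear_combination -hJS
  have hne : 1 - g.g12 ^ 2 / g.g10 ^ 2 ≠ 0 := by
    intro h
    rw [(div_eq_one_iff_eq (by positivity)).1 (sub_eq_zero.1 h).symm] at hJS
    linarith [mul_pos hα' hcap]
  have h2f3 : (2 : ℝ) ^ f3 g P2 α v.2.2 - g.g12 ^ 2 / g.g10 ^ 2 =
      (1 - g.g12 ^ 2 / g.g10 ^ 2) / (1 + g.g10 ^ 2 * v.2.1) := by
    rw [hf3, Real.rpow_sub two_pos, two_rpow_cap (by positivity), two_rpow_cap (by positivity)]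
    field_simp
    ring
  have hρ11 : (P1 - (1 - α) * v.2.2) / α = v.2.1 := by
    rw [div_eq_iff hα0.ne', ← hv.2, hp]
    ring
  rw [f4, h2f3, div_div_cancel₀ hne, hρ11]
  field_simp
  ring

theorem IsKKT.a4_mul_a2_eq (hg : g.Pos) (hP1 : 0 < P1) (hP2 : 0 < P2) (hα0 : 0 < α) (hα : α < 1)
    (h : IsKKT g P1 P2 α x m) (hm : m.lam0 = 0) :
    a4 g P2 α x.ρ13 * a2 g x.ρ11 = a2 g (effPower g P2 α x.powers) := by
  have hv := (h.powers_mem hg).1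
  have hlam1 : m.lam1 = 1 := by linarith [(h.stationary hg hP1 hP2 hα0 hα).1]
  have hm1 : 0 < m.lam1 := hlam1 ▸ one_pos
  obtain ⟨-, E11, E13⟩ := h.stationary_powers hg hP1 hP2 hα0 hα
  rw [h.mu11_eq_zero (h.snd_pos hg hP2 hα hm1), zero_mul, add_zero, hm, zero_div, zero_add]
    at E11
  rw [h.mu13_eq_zero (h.thd_pos hg hP1 hP2 hα0 hα hm1), zero_mul, add_zero] at E13
  have hA := a2_pos hg hv.2.1
  have hD := a2_pos hg (effPower_pos hg hP2 hα hv).le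
  have e := E13.trans E11.symm
  simp only [hlam1, Point.powers] at e hA hD ⊢
  field_simp at e
  exact e

theorem IsKKT.case2b (hg : g.Pos) (hP1 : 0 < P1) (hP2 : 0 < P2) (hα0 : 0 < α) (hα : α < 1)
    (h : IsKKT g P1 P2 α x m) (hc : Case2b m) : Case2bConclusion g P1 P2 α x m := by
  have hv := h.powers_mem hg
  have hp := h.fst_eq_zero hc.2
  have hq := h.thd_pos hg hP1 hP2 hα0 hα hc.1
  have hr := h.snd_pos hg hP2 hα hc.1
  have hRpos := (h.isOptimal hg hP1 hP2 hα0 hα).rate_pos hg hP1 hP2 hα0 hα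
  have hS := h.rate_eq_S4 hc.1
  refine ⟨hS, hp, hq, ?_, fun hlam0 => ⟨h.rate_eq_J1 hlam0, ?_⟩, fun hlam0 => ?_,
    h.2.1.usesScheme_df hg hP2 hα0 hα hRpos hp hr hq⟩
  · have hP : α * x.ρ11 + (1 - α) * (x.ρ10 + x.ρ13) = P1 := hv.2
    rw [← hP, hp]
    field_simp
    ring
  · refine f4_eq_zero hg hP2 hα0 hα hv hp ?_
    rw [← Point.J1_eq g P2, ← Point.S4_eq hg, ← h.rate_eq_J1 hlam0, hS]
  · rw [h.a4_mul_a2_eq hg hP1 hP2 hα0 hα hlam0, effPower, a2]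
    simp only [Point.powers, hp, zero_add]

theorem IsKKT.lam0_eq_one (hg : g.Pos) (hP1 : 0 < P1) (hP2 : 0 < P2) (hα0 : 0 < α) (hα : α < 1)
    (h : IsKKT g P1 P2 α x m) (hm : m.lam1 = 0) : m.lam0 = 1 := by
  rw [← (h.stationary hg hP1 hP2 hα0 hα).1, hm, add_zero]

theorem IsKKT.mu13_pos (hg : g.Pos) (hP1 : 0 < P1) (hP2 : 0 < P2) (hα0 : 0 < α) (hα : α < 1)
    (h : IsKKT g P1 P2 α x m) (hm : m.lam1 = 0) : 0 < m.mu13 := by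
  obtain ⟨E10, -, E13⟩ := h.stationary_powers hg hP1 hP2 hα0 hα
  rw [hm, h.lam0_eq_one hg hP1 hP2 hα0 hα hm, zero_div, add_zero] at E10
  rw [hm, zero_div, zero_mul, zero_add, ← E10] at E13
  have hA : 0 < a2 g x.ρ10 := a2_pos hg (h.powers_mem hg).1.1
  have hlog : 0 < Real.log 2 / (1 - α) := div_pos (Real.log_pos one_lt_two) (sub_pos.2 hα)
  obtain ⟨-, -, -, -, -, h10, -⟩ := h
  have : 0 < m.mu13 * (Real.log 2 / (1 - α)) := E13 ▸ by positivity
  exact pos_of_mul_pos_left this hlog.le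

theorem IsKKT.thd_eq_zero (h : IsKKT g P1 P2 α x m) (hm : 0 < m.mu13) : x.ρ13 = 0 := by
  obtain ⟨-, -, -, -, -, -, -, -, -, -, c13, -⟩ := h
  exact (mul_eq_zero.1 c13).resolve_left hm.ne'

-- Water-filling: `a2 g ρ10` and `a3 g ρ11` are the water levels of the two phases.
theorem IsKKT.one_div_a2_eq (hg : g.Pos) (hP1 : 0 < P1) (hP2 : 0 < P2) (hα0 : 0 < α) (hα : α < 1)
    (h : IsKKT g P1 P2 α x m) (hc : Case3a m) :
    1 / a2 g x.ρ10 = 1 / a3 g x.ρ11 + m.mu11 * (Real.log 2 / α) := by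
  obtain ⟨E10, E11, -⟩ := h.stationary_powers hg hP1 hP2 hα0 hα
  have hlam0 := h.lam0_eq_one hg hP1 hP2 hα0 hα hc.1
  rw [hc.1, hlam0, hc.2, zero_div, zero_mul, add_zero, add_zero] at E10
  rw [hc.1, hlam0, zero_div, add_zero] at E11
  rw [E10, E11]

theorem IsKKT.snd_pos_of_case3a (hg : g.Pos) (hP1 : 0 < P1) (hP2 : 0 < P2) (hα0 : 0 < α)
    (hα : α < 1) (ha1 : 0 < P1 + (1 - α) * a1 g) (h : IsKKT g P1 P2 α x m) (hc : Case3a m) :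
    0 < x.ρ11 := by
  have hv := h.powers_mem hg
  have hP : α * x.ρ11 + (1 - α) * (x.ρ10 + x.ρ13) = P1 := hv.2
  have hmu11 : 0 ≤ m.mu11 * (Real.log 2 / α) := by
    obtain ⟨-, -, -, -, -, -, h11, -⟩ := h
    exact mul_nonneg h11 (div_pos (Real.log_pos one_lt_two) hα0).le
  have hle : a2 g x.ρ10 ≤ a3 g x.ρ11 :=
    (one_div_le_one_div (a3_pos hg hv.1.2.1) (a2_pos hg hv.1.1)).1
      (h.one_div_a2_eq hg hP1 hP2 hα0 hα hc ▸ le_add_of_nonneg_right hmu11)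
  refine hv.1.2.1.lt_of_ne' fun hr => ?_
  change x.ρ11 = 0 at hr
  rw [hr, h.thd_eq_zero (h.mu13_pos hg hP1 hP2 hα0 hα hc.1), mul_zero, zero_add, add_zero] at hP
  rw [a2, a3, hr] at hle
  rw [← hP, ← mul_add] at ha1
  have hpos : 0 < x.ρ10 + a1 g := pos_of_mul_pos_right ha1 (sub_nonneg.2 hα.le)
  rw [a1] at hpos
  linarith

theorem IsKKT.snd_eq_fst_add_a1 (hg : g.Pos) (hP1 : 0 < P1) (hP2 : 0 < P2) (hα0 : 0 < α)
    (hα : α < 1) (h : IsKKT g P1 P2 α x m) (hc : Case3a m) (hr : 0 < x.ρ11) :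
    x.ρ11 = x.ρ10 + a1 g := by
  have e := h.one_div_a2_eq hg hP1 hP2 hα0 hα hc
  rw [h.mu11_eq_zero hr, zero_mul, add_zero, one_div, one_div, inv_inj, a2, a3] at e
  rw [a1]
  linear_combination -e

theorem IsKKT.case3a (hg : g.Pos) (hP1 : 0 < P1) (hP2 : 0 < P2) (hα0 : 0 < α) (hα : α < 1)
    (ha1 : 0 < P1 + (1 - α) * a1 g) (h : IsKKT g P1 P2 α x m) (hc : Case3a m) :
    Case3aConclusion g P1 P2 α x m := by
  have hmu13 := h.mu13_pos hg hP1 hP2 hα0 hα hc.1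
  have hr := h.snd_pos_of_case3a hg hP1 hP2 hα0 hα ha1 hc
  have hρ11 := h.snd_eq_fst_add_a1 hg hP1 hP2 hα0 hα hc hr
  have hq := h.thd_eq_zero hmu13
  have hpos : 0 < m.lam0 := h.lam0_eq_one hg hP1 hP2 hα0 hα hc.1 ▸ one_pos
  have hJ := h.rate_eq_J1 hpos
  have hRpos := (h.isOptimal hg hP1 hP2 hα0 hα).rate_pos hg hP1 hP2 hα0 hα
  have hP : α * x.ρ11 + (1 - α) * (x.ρ10 + x.ρ13) = P1 := (h.powers_mem hg).2
  rw [hq, add_zero] at hP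
  exact ⟨hpos, hmu13, hJ, hq, by linear_combination hP + (1 - α) * hρ11,
    by linear_combination hP - α * hρ11,
    fun hp => h.2.1.usesScheme_pdfNoRepetition hg hP2 hα0 hα hRpos hJ hp hr hq,
    fun hp => h.2.1.usesScheme_twoHop hg hP2 hα0 hα hRpos hp hr hq⟩

theorem IsKKT.case3b (hg : g.Pos) (hP1 : 0 < P1) (hP2 : 0 < P2) (hα0 : 0 < α) (hα : α < 1)
    (h : IsKKT g P1 P2 α x m) (hc : Case3b m) : Case3bConclusion g P1 P2 α x m := by
  have hmu13 := h.mu13_pos hg hP1 hP2 hα0 hα hc.1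
  have hp := h.fst_eq_zero hc.2
  have hq := h.thd_eq_zero hmu13
  have hpos : 0 < m.lam0 := h.lam0_eq_one hg hP1 hP2 hα0 hα hc.1 ▸ one_pos
  have hRpos := (h.isOptimal hg hP1 hP2 hα0 hα).rate_pos hg hP1 hP2 hα0 hα
  have hP : α * x.ρ11 + (1 - α) * (x.ρ10 + x.ρ13) = P1 := (h.powers_mem hg).2
  have hρ11 : x.ρ11 = P1 / α := by
    rw [eq_div_iff hα0.ne', ← hP, hp, hq]
    ring
  exact ⟨hpos, hmu13, h.rate_eq_J1 hpos, hq, hp, hρ11,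
    h.2.1.usesScheme_twoHop hg hP2 hα0 hα hRpos hp (hρ11 ▸ div_pos hP1 hα0) hq⟩

-- `J₁ < S₄` where user 1 spends all its power on `w10`, and `S₄ ≤ J₁` at the KKT point.
theorem IsKKT.exists_J1_eq_S4 (hg : g.Pos) (hP1 : 0 ≤ P1) (hP2 : 0 < P2) (hα : α < 1)
    (h : IsKKT g P1 P2 α x m) (hm : 0 < m.lam1) :
    ∃ y : Point, y.ValidPower P1 α ∧ y.J1 g P2 α = y.S4 g P2 α := by
  obtain ⟨hv, hJ, -⟩ := (Point.feasible_iff hg).1 h.2.1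
  rw [h.rate_eq_S4 hm, Point.S4_eq hg] at hJ
  have hw := vertex_fst_mem hP1 hα
  have hsub : powerSimplex P1 α ⊆ Set.Ici 0 := fun _ h => h.1
  obtain ⟨v, hv, e⟩ := (convex_powerSimplex P1 α).isPreconnected.intermediate_value₂ hw hv
    ((continuousOn_relayJ g α).mono hsub) ((continuousOn_relayS hg hP2 hα).mono hsub)
    (relayJ_lt_relayS hg hP2 hα hw.1 rfl).le hJ
  refine ⟨⟨0, v.1, v.2.1, v.2.2⟩, Point.validPower_iff.2 hv, ?_⟩
  rw [Point.J1_eq, Point.S4_eq hg]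
  exact e

theorem add_mul_a1_pos (hg10 : 0 < g.g10) (hle : g.g10 ≤ g.g12) (hP1 : 0 < P1) (hα : α ≤ 1) :
    0 < P1 + (1 - α) * a1 g := by
  have ha1 : 0 ≤ a1 g := by
    rw [a1, sub_nonneg]
    gcongr
  exact add_pos_of_pos_of_nonneg hP1 (mul_nonneg (sub_nonneg.2 hα) ha1)

theorem IsKKT.case3a_or_case3b (hg : g.Pos) (hP1 : 0 ≤ P1) (hP2 : 0 < P2) (hα : α < 1)
    (h : IsKKT g P1 P2 α x m)
    (hne : ∀ y : Point, y.ValidPower P1 α → y.J1 g P2 α ≠ y.S4 g P2 α) :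
    Case3a m ∨ Case3b m := by
  have hlam1 : ¬0 < m.lam1 := fun hm =>
    let ⟨y, hy, e⟩ := h.exists_J1_eq_S4 hg hP1 hP2 hα hm
    hne y hy e
  rcases h.cases with hc | hc | hc | hc
  · exact absurd hc.1 hlam1
  · exact absurd hc.1 hlam1
  · exact .inl hc
  · exact .inr hc

/-! ### Reduction of the three-phase scheme to the relay problem -/

variable {d : Design} {Q : ℝ}

theorem Point.ValidPower.feasible_relayDesign (hP2 : 0 ≤ P2) (hα0 : 0 ≤ α) (hα : α < 1)
    (hx : x.ValidPower P1 α) : (relayDesign P2 α x).Feasible P1 P2 := by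
  obtain ⟨hsum, h10, h11, h13⟩ := hx
  have hβ := sub_pos.2 hα
  refine ⟨hα0, le_rfl, by simpa [relayDesign] using hα.le, h10, le_rfl, h11, le_rfl, h13,
    div_nonneg hP2 hβ.le, ?_, ?_⟩
  · simpa [relayDesign, Design.α3] using hsum
  · simp only [relayDesign, Design.α3, rho23]
    field_simp
    ring

theorem Point.Feasible.inRegion_relayDesign (hg : g.Pos) (hP2 : 0 < P2) (hα : α < 1)
    (hx : x.Feasible g P1 P2 α) (hR : 0 ≤ x.R) : (relayDesign P2 α x).InRegion g x.R 0 := by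
  obtain ⟨hv, hJ, hS⟩ := (Point.feasible_iff hg).1 hx
  have hle := mul_cap_fst_le_mul_cap_effPower hg hP2 hα hv.1
  simp only [relayJ, relayS, Point.powers] at hJ hS hle
  simp only [Design.InRegion, Design.J1, Design.J2, Design.S1, Design.S2, Design.S3, Design.S4,
    Design.I1, Design.I2, Design.I3, Design.I4, Design.I5, Design.I6, Design.I7, Design.I8,
    zeta_relayDesign hg, Design.α3, Point.powers]
  simp only [relayDesign, mul_zero, cap_zero, add_zero, zero_add, sub_zero]
  exact ⟨hR, le_rfl, hJ, le_rfl, hJ, hS, hJ.trans (by gcongr), hS⟩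

theorem Design.Feasible.α3_nonneg (hd : d.Feasible P1 P2) : 0 ≤ d.α3 := by
  obtain ⟨-, -, hsum, -⟩ := hd
  rw [Design.α3]
  linarith

/-- The point of the relay problem with rate `R` obtained from a three-phase design by spreading
the powers which user 1 spends in phase 3 evenly over phases 2 and 3. -/
noncomputable def averagedPoint (d : Design) (R : ℝ) : Point where
  R := R
  ρ10 := d.α3 * d.ρ10 / (1 - d.α1)
  ρ11 := d.ρ11
  ρ13 := d.α3 * d.ρ13 / (1 - d.α1)

theorem Design.Feasible.validPower_averagedPoint (hα : d.α1 < 1) (hd : d.Feasible P1 P2) (R : ℝ) :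
    (averagedPoint d R).ValidPower P1 d.α1 := by
  have h3 := hd.α3_nonneg
  have hβ := sub_pos.2 hα
  obtain ⟨-, -, -, h10, -, h11, -, h13, -, hp1, -⟩ := hd
  refine ⟨?_, div_nonneg (mul_nonneg h3 h10) hβ.le, h11, div_nonneg (mul_nonneg h3 h13) hβ.le⟩
  rw [← hp1]
  simp only [averagedPoint]
  field_simp

theorem Design.Feasible.J1_le_averagedPoint (hα : d.α1 < 1) (hd : d.Feasible P1 P2) (R : ℝ) :
    d.J1 g ≤ (averagedPoint d R).J1 g P2 d.α1 := by
  have h3 := hd.α3_nonneg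
  have hsum : d.α3 + d.α2 = 1 - d.α1 := by rw [Design.α3]; ring
  obtain ⟨-, h2, -, h10, -⟩ := hd
  have h := mul_cap_add_mul_cap_le_mul_cap_div h3 h2 (hsum ▸ sub_pos.2 hα)
    (show 0 ≤ g.g10 ^ 2 * d.ρ10 by positivity) le_rfl
  rw [hsum, cap_zero, mul_zero, add_zero, add_zero, mul_left_comm, mul_div_assoc] at h
  rw [Point.J1_eq]
  simp only [Design.J1, Design.I1, Design.I3, relayJ, Point.powers, averagedPoint]
  gcongr

-- The cross term of `ζ` is a geometric mean of powers, and `α₃ ρ₂₃ ≤ P₂`.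
theorem Design.Feasible.mul_sqrt_le (hα : d.α1 < 1) (hd : d.Feasible P1 P2) (R : ℝ) :
    d.α3 * √(d.ρ13 * d.ρ23) ≤
      (1 - d.α1) * √((averagedPoint d R).ρ13 * rho23 P2 d.α1) := by
  have h3 := hd.α3_nonneg
  have hβ := sub_pos.2 hα
  obtain ⟨-, h2, -, -, h20, -, h22, h13, -, -, hp2⟩ := hd
  have hP2 : d.α3 * d.ρ23 ≤ P2 := by
    linarith [mul_nonneg h2 h22, mul_nonneg h3 h20]
  rw [← Real.sqrt_sq h3, ← Real.sqrt_sq hβ.le, ← Real.sqrt_mul (sq_nonneg _),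
    ← Real.sqrt_mul (sq_nonneg _)]
  refine Real.sqrt_le_sqrt ?_
  calc d.α3 ^ 2 * (d.ρ13 * d.ρ23) = d.α3 * d.ρ13 * (d.α3 * d.ρ23) := by ring
    _ ≤ d.α3 * d.ρ13 * P2 := by gcongr
    _ = (1 - d.α1) ^ 2 * ((averagedPoint d R).ρ13 * rho23 P2 d.α1) := by
      simp only [averagedPoint, rho23]
      field_simp

theorem Design.Feasible.received_le_averagedPoint (hg : g.Pos) (hα : d.α1 < 1)
    (hd : d.Feasible P1 P2) (R : ℝ) :
    d.α2 * (g.g20 ^ 2 * d.ρ22) + d.α3 * d.ζ g ≤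
      (1 - d.α1) * (relayDesign P2 d.α1 (averagedPoint d R)).ζ g := by
  have hβ := sub_pos.2 hα
  have hsqrt := hd.mul_sqrt_le hα R
  obtain ⟨-, -, -, -, -, -, -, -, -, -, hp2⟩ := hd
  have hg10 := hg.2.2.1.le
  have hg20 := hg.2.2.2.le
  have hρ10 : (1 - d.α1) * (averagedPoint d R).ρ10 = d.α3 * d.ρ10 := mul_div_cancel₀ _ hβ.ne'
  have hρ13 : (1 - d.α1) * (averagedPoint d R).ρ13 = d.α3 * d.ρ13 := mul_div_cancel₀ _ hβ.ne'
  have hρ23 : (1 - d.α1) * rho23 P2 d.α1 = P2 := mul_div_cancel₀ _ hβ.ne'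
  simp only [Design.ζ, relayDesign]
  linear_combination 2 * g.g10 * g.g20 * hsqrt - g.g10 ^ 2 * hρ10 - g.g10 ^ 2 * hρ13
    - g.g20 ^ 2 * hρ23 + g.g20 ^ 2 * hp2

theorem Design.Feasible.S4_le_averagedPoint (hg : g.Pos) (hα : d.α1 < 1)
    (hd : d.Feasible P1 P2) (R : ℝ) :
    d.S4 g ≤ (averagedPoint d R).S4 g P2 d.α1 := by
  have h3 := hd.α3_nonneg
  have hβ := sub_pos.2 hα
  have hsum : d.α2 + d.α3 = 1 - d.α1 := by rw [Design.α3]; ring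
  have hrec := hd.received_le_averagedPoint hg hα R
  obtain ⟨-, h2, -, h10, h20, -, h22, h13, h23, -⟩ := hd
  obtain ⟨-, -, hg10, hg20⟩ := hg
  have hζ : 0 ≤ d.ζ g := by
    rw [Design.ζ]
    positivity
  have hjensen := mul_cap_add_mul_cap_le_mul_cap_div h2 h3 (hsum ▸ hβ)
    (show 0 ≤ g.g20 ^ 2 * d.ρ22 by positivity) hζ
  have hmono := cap_le_cap (by positivity) ((div_le_iff₀' hβ).2 hrec)
  have hS4 : (averagedPoint d R).S4 g P2 d.α1 = d.α1 * cap (g.g10 ^ 2 * d.ρ11) +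
      (1 - d.α1) * cap ((relayDesign P2 d.α1 (averagedPoint d R)).ζ g) := by
    simp [Point.S4, Design.S4, Design.I8, relayDesign, Design.α3, averagedPoint]
  rw [hS4, Design.S4, Design.I8, add_assoc]
  rw [hsum] at hjensen
  gcongr
  exact hjensen.trans (by gcongr)

theorem IsOptimal.isGreatest (hg : g.Pos) (hP2 : 0 < P2) (hα0 : 0 ≤ α) (hα : α < 1)
    (h : IsOptimal g P1 P2 α x) (hR : 0 ≤ x.R) :
    IsGreatest (individualRatesAt g P1 P2 α) x.R := by
  refine ⟨⟨_, rfl, h.1.1.feasible_relayDesign hP2.le hα0 hα,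
    h.1.inRegion_relayDesign hg hP2 hα hR⟩, ?_⟩
  rintro R ⟨d, rfl, hd, -, -, hJ, -, -, -, -, hS⟩
  rw [add_zero] at hS
  exact h.2 (averagedPoint d R) ⟨hd.validPower_averagedPoint hα R,
    hJ.trans (hd.J1_le_averagedPoint hα R), hS.trans (hd.S4_le_averagedPoint hg hα R)⟩

/-! ### Direct transmission -/

theorem Design.Feasible.mul_cap_add_mul_cap_le (hd : d.Feasible P1 Q) (γ : ℝ) :
    d.α1 * cap (γ ^ 2 * d.ρ11) + d.α3 * cap (γ ^ 2 * d.ρ10) ≤ cap (γ ^ 2 * P1) := by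
  have h3 := hd.α3_nonneg
  obtain ⟨h1, h2, -, h10, -, h11, -, h13, -, hp1, -⟩ := hd
  refine (RelayMAC.mul_cap_add_mul_cap_le h1 h3 (by rw [Design.α3]; linarith)
    (by positivity) (by positivity)).trans (cap_le_cap (by positivity) ?_)
  calc d.α1 * (γ ^ 2 * d.ρ11) + d.α3 * (γ ^ 2 * d.ρ10)
      ≤ d.α1 * (γ ^ 2 * d.ρ11) + d.α3 * (γ ^ 2 * d.ρ10) + γ ^ 2 * (d.α3 * d.ρ13) :=
        le_add_of_nonneg_right (by positivity)
    _ = γ ^ 2 * P1 := by rw [← hp1]; ring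

theorem Design.Feasible.J1_le_cap (hg12 : 0 ≤ g.g12) (hle : g.g12 ≤ g.g10)
    (hd : d.Feasible P1 Q) : d.J1 g ≤ cap (g.g10 ^ 2 * P1) := by
  refine le_trans ?_ (hd.mul_cap_add_mul_cap_le g.g10)
  obtain ⟨h1, -, -, -, -, h11, -⟩ := hd
  exact add_le_add_left (mul_le_mul_of_nonneg_left (cap_le_cap (by positivity) (by gcongr)) h1) _

theorem eq_one_and_eq_of_cap_le_mul_cap {a x y : ℝ} (ha0 : 0 ≤ a) (ha : a ≤ 1) (hx0 : 0 ≤ x)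
    (hy : 0 < y) (hxy : a * x ≤ y) (h : cap y ≤ a * cap x) : a = 1 ∧ x = y := by
  have hpos : 0 < a * cap x := (cap_pos hy).trans_le h
  have ha0' : 0 < a := ha0.lt_of_ne' (left_ne_zero_of_mul hpos.ne')
  have hx0' : 0 < x := hx0.lt_of_ne' fun hx => by simp [hx, cap_zero] at hpos
  obtain rfl : a = 1 := ha.eq_of_not_lt fun ha1 => h.not_gt
    ((mul_cap_lt ha0' ha1 hx0').trans_le (cap_le_cap (by positivity) hxy))
  rw [one_mul] at hxy h
  exact ⟨rfl, hxy.eq_of_not_lt fun hlt => h.not_gt (cap_lt_cap hx0 hlt)⟩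

theorem Design.Feasible.eq_direct_of_cap_le_J1 (hg12 : 0 ≤ g.g12) (hlt : g.g12 < g.g10)
    (hP1 : 0 < P1) (hd : d.Feasible P1 Q) (h : cap (g.g10 ^ 2 * P1) ≤ d.J1 g) :
    d.α1 = 0 ∧ d.α2 = 0 ∧ d.ρ10 = P1 ∧ d.ρ13 = 0 := by
  have h3 := hd.α3_nonneg
  have hle := hd.mul_cap_add_mul_cap_le g.g10
  obtain ⟨h1, h2, -, h10, -, h11, -, h13, -, hp1, -⟩ := hd
  have hg10 : 0 < g.g10 := hg12.trans_lt hlt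
  have hα3 : d.α3 = 1 - d.α1 - d.α2 := rfl
  rw [Design.J1, Design.I1, Design.I3] at h
  have hphase1 : d.α1 * d.ρ11 = 0 := by
    by_contra hne
    have hα1 : 0 < d.α1 := h1.lt_of_ne' (left_ne_zero_of_mul hne)
    have hρ11 : 0 < d.ρ11 := h11.lt_of_ne' (right_ne_zero_of_mul hne)
    refine (h.trans_lt ((add_lt_add_iff_right _).2 ?_)).not_ge hle
    exact mul_lt_mul_of_pos_left (cap_lt_cap (by positivity) (by gcongr)) hα1
  have hcap1 : d.α1 * cap (g.g12 ^ 2 * d.ρ11) = 0 := by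
    rcases mul_eq_zero.1 hphase1 with h | h <;> simp [h, cap_zero]
  rw [hcap1, zero_add] at h
  rw [hphase1, zero_add] at hp1
  have hpower : d.α3 * (g.g10 ^ 2 * d.ρ10) ≤ g.g10 ^ 2 * P1 := by
    rw [mul_left_comm, ← hp1]
    gcongr
    exact le_add_of_nonneg_right h13
  obtain ⟨hone, hρ10⟩ := eq_one_and_eq_of_cap_le_mul_cap h3 (by linarith) (by positivity)
    (by positivity) hpower h
  have hρ10 : d.ρ10 = P1 := mul_left_cancel₀ (pow_pos hg10 2).ne' hρ10
  rw [hone, one_mul, hρ10] at hp1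
  exact ⟨by linarith, by linarith, hρ10, by linarith⟩

theorem direct_feasible (hP1 : 0 ≤ P1) (hQ : 0 ≤ Q) :
    (⟨0, 0, P1, 0, 0, 0, 0, Q⟩ : Design).Feasible P1 Q := by
  simp [Design.Feasible, Design.α3, hP1, hQ]

theorem direct_inRegion (g : Gains) (hP1 : 0 ≤ P1) (hQ : 0 ≤ Q) :
    (⟨0, 0, P1, 0, 0, 0, 0, Q⟩ : Design).InRegion g (cap (g.g10 ^ 2 * P1)) 0 := by
  have h0 : 0 ≤ cap (g.g10 ^ 2 * P1) := cap_nonneg (by positivity)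
  have hle : cap (g.g10 ^ 2 * P1) ≤ cap (g.g10 ^ 2 * P1 + g.g20 ^ 2 * Q) :=
    cap_le_cap (by positivity) (le_add_of_nonneg_right (by positivity))
  simp [Design.InRegion, Design.J1, Design.J2, Design.S1, Design.S2, Design.S3, Design.S4,
    Design.I1, Design.I2, Design.I3, Design.I4, Design.I5, Design.I6, Design.I7, Design.I8,
    Design.ζ, Design.α3, cap_zero, h0, hle]

theorem direct_isGreatest (hg12 : 0 ≤ g.g12) (hle : g.g12 ≤ g.g10) (hP1 : 0 ≤ P1) (hQ : 0 ≤ Q) :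
    IsGreatest (individualRates g P1 Q) (cap (g.g10 ^ 2 * P1)) :=
  ⟨⟨_, direct_feasible hP1 hQ, direct_inRegion g hP1 hQ⟩, fun _ ⟨_, hd, hR⟩ =>
    hR.2.2.1.trans (hd.J1_le_cap hg12 hle)⟩

theorem direct_usesScheme (hg10 : g.g10 ≠ 0) (hP1 : 0 < P1) :
    UsesScheme g ⟨0, 0, P1, 0, 0, 0, 0, 0⟩ (cap (g.g10 ^ 2 * P1)) IsDirect := by
  have hcap : 0 < cap (g.g10 ^ 2 * P1) := cap_pos (by positivity)
  refine ⟨⟨⟨cap (g.g10 ^ 2 * P1), 0, 0, 0⟩, ?_⟩, fun s hs => ?_⟩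
  · simp [Delivers, Decodable, Design.I1, Design.I2, Design.I3, Design.I4, Design.I5, Design.I6,
      Design.I7, Design.I8, Design.ζ, Design.α3, cap_zero, hcap.le]
  · obtain ⟨⟨-, h12, -, -, hI1, -⟩, hR, -⟩ := hs
    have hR12 : s.R12 = 0 := le_antisymm (by simpa [Design.I1] using hI1) h12
    have hR10 : 0 < s.R10 := by linarith
    refine ⟨rfl, rfl, hR12, ?_, rfl, rfl, rfl⟩
    ext m
    cases m <;> simp [sent13, Design.α3, RateSplit.rate, hR10, hP1]

end RelayMAC

theorem theorem2_general (g : Gains) (hg : g.Pos) (P1 : ℝ) (hP1 : 0 < P1) :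
    (g.g12 < g.g10 →
      (∀ Q : ℝ, 0 ≤ Q →
        IsGreatest (individualRates g P1 Q) (cap (g.g10 ^ 2 * P1)) ∧
        ∀ d : Design, d.Feasible P1 Q → d.InRegion g (cap (g.g10 ^ 2 * P1)) 0 →
          d.α1 = 0 ∧ d.α2 = 0 ∧ d.ρ10 = P1 ∧ d.ρ13 = 0) ∧
      (⟨0, 0, P1, 0, 0, 0, 0, 0⟩ : Design).Feasible P1 0 ∧
      (⟨0, 0, P1, 0, 0, 0, 0, 0⟩ : Design).InRegion g (cap (g.g10 ^ 2 * P1)) 0 ∧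
      UsesScheme g ⟨0, 0, P1, 0, 0, 0, 0, 0⟩ (cap (g.g10 ^ 2 * P1)) IsDirect) ∧
    ∀ P2 α : ℝ, 0 < P2 → 0 < α → α < 1 →
      (∃! x : Point, IsOptimal g P1 P2 α x) ∧
      (∀ x : Point, IsOptimal g P1 P2 α x ↔ ∃ m : Multipliers, IsKKT g P1 P2 α x m) ∧
      (∀ x : Point, IsOptimal g P1 P2 α x →
        (relayDesign P2 α x).Feasible P1 P2 ∧ (relayDesign P2 α x).InRegion g x.R 0 ∧
        IsGreatest (individualRatesAt g P1 P2 α) x.R) ∧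
      (∀ (x : Point) (m : Multipliers), IsKKT g P1 P2 α x m →
        (Case2a m ∨ Case2b m ∨ Case3a m ∨ Case3b m) ∧
        (Case2a m → Case2aConclusion g P1 P2 α x m) ∧
        (Case2b m → Case2bConclusion g P1 P2 α x m) ∧
        (0 < P1 + (1 - α) * a1 g → Case3a m → Case3aConclusion g P1 P2 α x m) ∧
        (Case3b m → Case3bConclusion g P1 P2 α x m) ∧
        ((∀ y : Point, y.ValidPower P1 α → y.J1 g P2 α ≠ y.S4 g P2 α) →
          Case3a m ∨ Case3b m)) := by
  refine ⟨fun hlt => ⟨fun Q hQ => ⟨direct_isGreatest hg.1.le hlt.le hP1.le hQ, fun d hd hR =>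
      hd.eq_direct_of_cap_le_J1 hg.1.le hlt hP1 hR.2.2.1⟩, direct_feasible hP1.le le_rfl,
    direct_inRegion g hP1.le le_rfl, direct_usesScheme hg.2.2.1.ne' hP1⟩,
    fun P2 α hP2 hα0 hα => ⟨existsUnique_isOptimal hg hP1.le hP2 hα0 hα,
    fun x => ⟨fun h => h.exists_isKKT hg hP1 hP2 hα0 hα, fun ⟨m, h⟩ =>
      h.isOptimal hg hP1 hP2 hα0 hα⟩, fun x h => ?_, fun x m h => ⟨h.cases,
    h.case2a hg hP1 hP2 hα0 hα, h.case2b hg hP1 hP2 hα0 hα,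
    fun ha1 => h.case3a hg hP1 hP2 hα0 hα ha1, h.case3b hg hP1 hP2 hα0 hα,
    h.case3a_or_case3b hg hP1.le hP2 hα⟩⟩⟩
  have hR : 0 ≤ x.R := (h.rate_pos hg hP1 hP2 hα0 hα).le
  exact ⟨h.1.1.feasible_relayDesign hP2.le hα0.le hα, h.1.inRegion_relayDesign hg hP2 hα hR,
    h.isGreatest hg hP2 hα0.le hα hR⟩

theorem theorem2 (g : Gains) (hg : g.Pos) (P1 P2 : ℝ) (hP1 : 0 < P1) (hP2 : 0 < P2) :
    -- If the inter-user link is weaker than the direct link, direct transmission is optimal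
    -- over all phase durations and powers, whatever power `Q` user 2 spends.
    (g.g12 < g.g10 →
      (∀ Q : ℝ, 0 ≤ Q → Q ≤ P2 →
        IsGreatest (individualRates g P1 Q) (cap (g.g10 ^ 2 * P1)) ∧
        ∀ d : Design, d.Feasible P1 Q → d.InRegion g (cap (g.g10 ^ 2 * P1)) 0 →
          d.α1 = 0 ∧ d.α2 = 0 ∧ d.ρ10 = P1 ∧ d.ρ13 = 0) ∧
      (⟨0, 0, P1, 0, 0, 0, 0, 0⟩ : Design).Feasible P1 0 ∧
      (⟨0, 0, P1, 0, 0, 0, 0, 0⟩ : Design).InRegion g (cap (g.g10 ^ 2 * P1)) 0 ∧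
      UsesScheme g ⟨0, 0, P1, 0, 0, 0, 0, 0⟩ (cap (g.g10 ^ 2 * P1)) IsDirect) ∧
    -- Otherwise, for a fixed duration `α` of phase 1:
    (g.g10 ≤ g.g12 → ∀ α : ℝ, 0 < α → α < 1 →
      -- the relay problem has exactly one solution, and the KKT conditions characterize it;
      (∃! x : Point, IsOptimal g P1 P2 α x) ∧
      (∀ x : Point, IsOptimal g P1 P2 α x ↔ ∃ m : Multipliers, IsKKT g P1 P2 α x m) ∧
      -- its value is the best individual rate of the three-phase scheme with this `α`;
      (∀ x : Point, IsOptimal g P1 P2 α x →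
        (relayDesign P2 α x).Feasible P1 P2 ∧ (relayDesign P2 α x).InRegion g x.R 0 ∧
        IsGreatest (individualRatesAt g P1 P2 α) x.R) ∧
      -- the KKT solution determines the optimal scheme.
      (∀ (x : Point) (m : Multipliers), IsKKT g P1 P2 α x m →
        (Case2a m ∨ Case2b m ∨ Case3a m ∨ Case3b m) ∧
        (Case2a m → Case2aConclusion g P1 P2 α x m) ∧
        (Case2b m → Case2bConclusion g P1 P2 α x m) ∧
        (Case3a m → Case3aConclusion g P1 P2 α x m) ∧
        (Case3b m → Case3bConclusion g P1 P2 α x m) ∧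
        ((∀ y : Point, y.ValidPower P1 α → y.J1 g P2 α ≠ y.S4 g P2 α) →
          Case3a m ∨ Case3b m))) := by
  obtain ⟨direct, relay⟩ := theorem2_general g hg P1 hP1
  exact ⟨fun hlt => ⟨fun Q hQ _ => (direct hlt).1 Q hQ, (direct hlt).2⟩, fun hle α hα0 hα => by
    simpa only [add_mul_a1_pos hg.2.2.1 hle hP1 hα.le, true_imp_iff] using relay P2 α hP2 hα0 hα⟩
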